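/- Let $k>0$ and $R>0$ satisfy $kR\ge 2$, let $B_R=\{x\in\mathbb R^3:|x|<R\}$, let $D\subset \overline{B_R}$, and let $u$ be a solution of the Helmholtz equation $(\Delta+k^2)u=0$ in $\mathbb R^3\setminus\overline D$ satisfying the Sommerfeld radiation condition $\lim_{r\to\infty} r(\partial_r u-iku)(x)=0$, $r=|x|$ (uniformly in the direction $\sigma=x/r$). Let $A$ be its scattering amplitude, i.e. $u(x)=\frac{e^{ikr}}{r}A(\sigma)+O(r^{-2})$ as $r\to\infty$, uniformly in $\sigma$. Let $Y_n^m$ ($n=0,1,2,\dots$, $m=-n,\dots,n$) be an orthonormal base of $L^2$ of the unit sphere, $Y_n^m$ being a spherical harmonic of degree $n$. For a function $f$ on the unit sphere with coefficients $f_{m,n}$ with respect to $Y_n^m$ put $|f_n|^2=\sum_{m=-n}^{n}|f_{m,n}|^2$; for a function $v$ on $\partial B_R$ let $|v_n|$ be formed from $\sigma\mapsto v(R\sigma)$, and for $l=0,1$ define $$\|v\|^2_{(l)}(\partial B_R)=R^2\sum_{j=0}^{l}\sum_{n=0}^{\infty}\Big(\frac nR\Big)^{2j}|v_n|^2\in[0,\infty].$$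 Let $|a_n|^2=|A_n|^2$, $N=[\sqrt{kR}]$ (integer part), $\varepsilon_1,\varepsilon_2\ge0$ with $\varepsilon_1^2=\sum_{n=0}^N|a_n|^2$ and $\varepsilon_2^2=\sum_{n=N+1}^\infty|a_n|^2$, and $E=-\log\varepsilon_2$. Assume that $\varepsilon_2\le 1$, and that $\partial_r u$ has an $L^2$ trace on $\partial B_R$ from outside (which is automatic if $\overline D\subset B_R$). Then $$\|\partial_r u\|^2_{(0)}(\partial B_R)\le \frac{e^2}{\pi}(3+\sqrt5)\,k^2\varepsilon_1^2+k^2e^{2/R}\varepsilon_2+\frac{R^2M_2^2}{E+k-2\sqrt{E+k}+1},\qquad M_2=\|\partial_r u\|_{(1)}(\partial B_R).$$ If $\varepsilon_2=0$ (so $E=+\infty$), the last two terms are read as $0$. If the denominator of the last term vanishes, i.e. $E+k=1$, that term is read as $+\infty$ when $M_2>0$ and as $0$ when $M_2=0$. -/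

import Mathlib

open MeasureTheory Filter Topology
open scoped ENNReal

noncomputable section

/-- Three-dimensional Euclidean space. -/
abbrev Space3 : Type := EuclideanSpace ℝ (Fin 3)

/-- The unit sphere of `Space3`. -/
abbrev Sphere2 : Type := Metric.sphere (0 : Space3) 1

/-- The surface measure of the unit sphere (total mass `4π`). -/
def surfaceMeasure : Measure Sphere2 := (volume : Measure Space3).toSphere

/-- `u` is a (classical) solution of the Helmholtz equation `Δu + k²u = 0` in the set `Ω`. -/
def IsHelmholtzSolution (k : ℝ) (Ω : Set Space3) (u : Space3 → ℂ) : Prop :=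
  ContDiffOn ℝ 2 u Ω ∧ ∀ x ∈ Ω, Laplacian.laplacian u x + (k : ℂ) ^ 2 * u x = 0

/-- The radial derivative `∂_r u` at `x`, i.e. the derivative in the direction `x / |x|`. -/
def radialDeriv (u : Space3 → ℂ) (x : Space3) : ℂ := fderiv ℝ u x (‖x‖⁻¹ • x)

/-- The Sommerfeld radiation condition: `r (∂_r u - i k u) → 0` as `r = |x| → ∞`. -/
def IsRadiating (k : ℝ) (u : Space3 → ℂ) : Prop :=
  Tendsto (fun x : Space3 => (‖x‖ : ℂ) * (radialDeriv u x - Complex.I * k * u x))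
    (Bornology.cobounded Space3) (𝓝 0)

/-- `A` is the scattering amplitude of `u`: `u(rσ) = (e^{ikr} / r) A(σ) + O(r⁻²)` as `r → ∞`,
uniformly in the direction `σ`. -/
def IsScatteringAmplitude (k : ℝ) (u : Space3 → ℂ) (A : Sphere2 → ℂ) : Prop :=
  ∃ C : ℝ, ∀ᶠ r : ℝ in atTop, ∀ σ : Sphere2,
    ‖u (r • (σ : Space3)) - Complex.exp (Complex.I * k * r) / r * A σ‖ ≤ C / r ^ 2

/-- `g` is the trace on the sphere `|x| = R` of `∂_r u`, taken from the outside, in the sense of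
`L²` and written as a function of the direction `σ`. If `u` is continuously differentiable near
that sphere, this is just `g(σ) = ∂_r u(Rσ)` (almost everywhere). -/
def IsRadialDerivTrace (R : ℝ) (u : Space3 → ℂ) (g : Sphere2 → ℂ) : Prop :=
  MemLp g 2 surfaceMeasure ∧
    Tendsto (fun r : ℝ =>
      eLpNorm (fun σ : Sphere2 => radialDeriv u (r • (σ : Space3)) - g σ) 2 surfaceMeasure)
      (𝓝[>] R) (𝓝 0)

/-- `f` is a spherical harmonic of degree `n`: the restriction to the unit sphere of a
homogeneous harmonic polynomial of degree `n`. -/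
def IsSphericalHarmonic (n : ℕ) (f : Sphere2 → ℂ) : Prop :=
  ∃ p : MvPolynomial (Fin 3) ℂ, p.IsHomogeneous n ∧
    ∑ i, MvPolynomial.pderiv i (MvPolynomial.pderiv i p) = 0 ∧
    ∀ σ : Sphere2, f σ = MvPolynomial.eval (fun i => (((σ : Space3) i : ℝ) : ℂ)) p

/-- `Y n m`, for `n = 0, 1, 2, …` and `m = -n, …, n`, is an orthonormal base of `L²` of the unit
sphere formed of spherical harmonics. Spherical harmonics of degree `n` form a space of dimension
`2n + 1`, so such an orthonormal family is automatically complete. The values of `Y n m` for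
`|m| > n` play no role. -/
structure IsSphericalHarmonicBase (Y : ℕ → ℤ → Sphere2 → ℂ) : Prop where
  isSphericalHarmonic : ∀ n : ℕ, ∀ m ∈ Finset.Icc (-(n : ℤ)) n, IsSphericalHarmonic n (Y n m)
  orthonormal : ∀ n : ℕ, ∀ m ∈ Finset.Icc (-(n : ℤ)) n,
    ∀ n' : ℕ, ∀ m' ∈ Finset.Icc (-(n' : ℤ)) n',
      ∫ σ, Y n m σ * (starRingEnd ℂ) (Y n' m' σ) ∂surfaceMeasure =
        if n = n' ∧ m = m' then 1 else 0

/-- The coefficient of `f` with respect to `Y n m`. -/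
def sphCoeff (Y : ℕ → ℤ → Sphere2 → ℂ) (f : Sphere2 → ℂ) (n : ℕ) (m : ℤ) : ℂ :=
  ∫ σ, f σ * (starRingEnd ℂ) (Y n m σ) ∂surfaceMeasure

/-- `|f_n|² = ∑_{m=-n}^{n} |f_{n,m}|²`, where `f_{n,m}` are the coefficients of `f`. -/
def degreeEnergy (Y : ℕ → ℤ → Sphere2 → ℂ) (f : Sphere2 → ℂ) (n : ℕ) : ℝ :=
  ∑ m ∈ Finset.Icc (-(n : ℤ)) n, ‖sphCoeff Y f n m‖ ^ 2

/-- The square of the Sobolev norm of order `l` on the sphere `|x| = R`, of the function whose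
value at `Rσ` is `f(σ)`: `R² ∑_{j=0}^{l} ∑_{n=0}^{∞} (n/R)^{2j} |f_n|²`, possibly infinite. -/
def sobolevNormSq (Y : ℕ → ℤ → Sphere2 → ℂ) (R : ℝ) (l : ℕ) (f : Sphere2 → ℂ) : ℝ≥0∞ :=
  ENNReal.ofReal (R ^ 2) * ∑ j ∈ Finset.range (l + 1), ∑' n : ℕ,
    ENNReal.ofReal (((n : ℝ) / R) ^ (2 * j) * degreeEnergy Y f n)

/-- `ε₁ = (∑_{n=0}^{N} |a_n|²)^{1/2}`. -/
def lowPart (Y : ℕ → ℤ → Sphere2 → ℂ) (N : ℕ) (A : Sphere2 → ℂ) : ℝ :=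
  Real.sqrt (∑ n ∈ Finset.range (N + 1), degreeEnergy Y A n)

/-- `ε₂ = (∑_{n=N+1}^{∞} |a_n|²)^{1/2}` (a convergent series for `A` in `L²`). -/
def highPart (Y : ℕ → ℤ → Sphere2 → ℂ) (N : ℕ) (A : Sphere2 → ℂ) : ℝ :=
  Real.sqrt (∑' n : ℕ, degreeEnergy Y A (N + 1 + n))

end

/-! Separation of variables reduces everything to one ODE per degree. For a spherical harmonic `f`
of degree `n`, let `w(r)` be the moment of `u(rσ)` against `f`. Then `r w(r)` solves the
Riccati-Bessel equation for `r > R`. Its radiation condition and its amplitude `a` force `r w(r) = a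
h(kr)`, where `h = hankel n` is an explicit finite sum. Letting `r` decrease to `R` gives `R g_f = k
a (h'(t) - h(t)/t)` with `t = kR` (`integral_trace_eq`).

The coefficients of `h` are dominated by those of an exponential series, so `|h' - h/t| ≤ e^q (1 +
(1 + q)/t)` with `q = n(n+1)/(2t)`. For `n² ≤ t` the square of this majorant is at most the constant
in front of `k² ε₁²` (`hankel_majorant_sq_le`). In general it is at most `exp(2(n+1)²/t)`
(`hankel_majorant_sq_le_exp`).

The degrees above `N` are split at `n + 1 = √(E + k)` (`high_frequency_le`). Below the threshold the
exponential is at most `e^{2/R} / ε₂`, which turns `ε₂²` into `ε₂`. Above it, `n ≥ √(E + k) - 1`,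
and the weight `n²` in the Sobolev norm supplies the denominator `(√(E + k) - 1)²`. -/

/-! ### Riccati-Hankel functions: differential equation and behaviour at infinity. -/

/-- The coefficients `(n + m)! / (2 ^ m * m! * (n - m)!)` of the reverse Bessel polynomials, which
vanish for `m > n`. -/
noncomputable def besselCoeff (n : ℕ) : ℕ → ℝ
  | 0 => 1
  | m + 1 => besselCoeff n m * (n * (n + 1) - m * (m + 1)) / (2 * (m + 1))

theorem besselCoeff_zero (n : ℕ) : besselCoeff n 0 = 1 := rfl

theorem besselCoeff_succ (n m : ℕ) :
    2 * ((m : ℝ) + 1) * besselCoeff n (m + 1)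
      = besselCoeff n m * (n * (n + 1) - m * (m + 1)) := by
  have : (m : ℝ) + 1 ≠ 0 := by positivity
  rw [besselCoeff]
  field_simp

theorem besselCoeff_succ_self (n : ℕ) : besselCoeff n (n + 1) = 0 := by
  simp [besselCoeff]

/-- For `m < n` the factor `n(n+1) - m(m+1)` lies between `0` and `n(n+1)`, so each step multiplies
by at most `(n(n+1)/2) / (m+1)`. -/
theorem besselCoeff_mem_Icc (n : ℕ) {m : ℕ} (hm : m ≤ n) :
    besselCoeff n m ∈ Set.Icc 0 (((n : ℝ) * (n + 1) / 2) ^ m / m.factorial) := by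
  induction m with
  | zero => simp [besselCoeff_zero]
  | succ m ih =>
    obtain ⟨h0, h1⟩ := ih (by omega)
    have hmn : (m : ℝ) ≤ n := by exact_mod_cast (by omega : m ≤ n)
    have hd : (m : ℝ) * (m + 1) ≤ n * (n + 1) := by gcongr
    rw [besselCoeff]
    refine ⟨by have := sub_nonneg.2 hd; positivity, ?_⟩
    rw [Nat.factorial_succ, pow_succ]
    push_cast
    calc besselCoeff n m * ((n : ℝ) * (n + 1) - m * (m + 1)) / (2 * (m + 1))
        ≤ (((n : ℝ) * (n + 1) / 2) ^ m / m.factorial) * (n * (n + 1)) / (2 * (m + 1)) := by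
          gcongr
          have : (0 : ℝ) ≤ m * (m + 1) := by positivity
          linarith
      _ = _ := by field_simp

/-- `hankelSum n t` is `e^{-it}` times the Riccati-Hankel function of degree `n`, up to a phase. -/
noncomputable def hankelSum (n : ℕ) (t : ℝ) : ℂ :=
  ∑ m ∈ Finset.range (n + 1), besselCoeff n m * (Complex.I / t) ^ m

/-- The image of `-hankelSum n` under the Euler operator `t d/dt`. -/
noncomputable def hankelEulerSum (n : ℕ) (t : ℝ) : ℂ :=
  ∑ m ∈ Finset.range (n + 1), m * (besselCoeff n m * (Complex.I / t) ^ m)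

/-- The outgoing Riccati-Hankel function of degree `n`, normalised to behave as `e^{it}`. -/
noncomputable def hankel (n : ℕ) (t : ℝ) : ℂ := Complex.exp (Complex.I * t) * hankelSum n t

/-- The derivative of `hankel n`. -/
noncomputable def hankelDeriv (n : ℕ) (t : ℝ) : ℂ :=
  Complex.exp (Complex.I * t) * (Complex.I * hankelSum n t - hankelEulerSum n t / t)

theorem hasDerivAt_I_div_pow (m : ℕ) {t : ℝ} (ht : t ≠ 0) :
    HasDerivAt (fun t : ℝ => (Complex.I / (t : ℂ)) ^ m)
      (-(m * (Complex.I / t) ^ m) / t) t := by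
  have htc : (t : ℂ) ≠ 0 := by exact_mod_cast ht
  have h := (((hasDerivAt_id (t : ℂ)).inv htc).const_mul Complex.I).pow m |>.comp_ofReal
  refine (h.congr_deriv ?_).congr_of_eventuallyEq (Eventually.of_forall fun x => ?_)
  · cases m with
    | zero => simp
    | succ m =>
      simp only [id, Nat.add_sub_cancel, pow_succ, Pi.inv_apply]
      field_simp
  · simp [div_eq_mul_inv]

theorem hasDerivAt_hankelSum (n : ℕ) {t : ℝ} (ht : t ≠ 0) :
    HasDerivAt (hankelSum n) (-hankelEulerSum n t / t) t := by
  have h : HasDerivAt (hankelSum n) (∑ m ∈ Finset.range (n + 1),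
      (besselCoeff n m : ℂ) * (-(m * (Complex.I / t) ^ m) / t)) t :=
    HasDerivAt.fun_sum fun m _ => (hasDerivAt_I_div_pow m ht).const_mul (besselCoeff n m : ℂ)
  refine h.congr_deriv ?_
  rw [hankelEulerSum, ← Finset.sum_neg_distrib, Finset.sum_div]
  exact Finset.sum_congr rfl fun m _ => by ring

theorem hasDerivAt_hankelEulerSum (n : ℕ) {t : ℝ} (ht : t ≠ 0) :
    HasDerivAt (hankelEulerSum n) (-(∑ m ∈ Finset.range (n + 1),
      (m : ℂ) ^ 2 * (besselCoeff n m * (Complex.I / t) ^ m)) / t) t := by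
  have h : HasDerivAt (hankelEulerSum n) (∑ m ∈ Finset.range (n + 1),
      (m : ℂ) * (besselCoeff n m * (-(m * (Complex.I / t) ^ m) / t))) t :=
    HasDerivAt.fun_sum fun m _ =>
      ((hasDerivAt_I_div_pow m ht).const_mul (besselCoeff n m : ℂ)).const_mul (m : ℂ)
  refine h.congr_deriv ?_
  rw [← Finset.sum_neg_distrib, Finset.sum_div]
  exact Finset.sum_congr rfl fun m _ => by ring

/-- This is the Riccati-Bessel equation with the factor `e^{it}` removed; comparing powers of `I /
t` gives exactly `besselCoeff_succ`. -/
theorem hankelSum_recurrence (n : ℕ) {t : ℝ} (ht : t ≠ 0) :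
    ∑ m ∈ Finset.range (n + 1), (m : ℂ) ^ 2 * (besselCoeff n m * (Complex.I / t) ^ m)
      + hankelEulerSum n t - 2 * Complex.I * t * hankelEulerSum n t
      = n * (n + 1) * hankelSum n t := by
  have htc : (t : ℂ) ≠ 0 := by exact_mod_cast ht
  -- Multiplying by `t` lowers the power of `I / t` by one, hence the index shift. The extra top
  -- term is `besselCoeff n (n + 1) = 0`.
  have key : 2 * Complex.I * t * hankelEulerSum n t = -∑ m ∈ Finset.range (n + 1),
      ((2 * ((m : ℝ) + 1) * besselCoeff n (m + 1) : ℝ) : ℂ) * (Complex.I / t) ^ m := by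
    rw [Finset.sum_range_succ, besselCoeff_succ_self, hankelEulerSum, Finset.sum_range_succ']
    simp only [Nat.cast_zero, zero_mul, add_zero, mul_zero, Complex.ofReal_zero]
    rw [Finset.mul_sum, ← Finset.sum_neg_distrib]
    refine Finset.sum_congr rfl fun m _ => ?_
    rw [pow_succ]
    push_cast
    field_simp
    rw [Complex.I_sq]
    ring
  rw [key, hankelEulerSum, hankelSum, sub_neg_eq_add, ← Finset.sum_add_distrib,
    ← Finset.sum_add_distrib, Finset.mul_sum]
  refine Finset.sum_congr rfl fun m _ => ?_
  rw [besselCoeff_succ]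
  push_cast
  ring

theorem hasDerivAt_exp_I_mul (t : ℝ) :
    HasDerivAt (fun t : ℝ => Complex.exp (Complex.I * t))
      (Complex.exp (Complex.I * t) * Complex.I) t := by
  simpa using (((hasDerivAt_id (t : ℂ)).const_mul Complex.I).cexp).comp_ofReal

theorem hasDerivAt_hankel (n : ℕ) {t : ℝ} (ht : t ≠ 0) :
    HasDerivAt (hankel n) (hankelDeriv n t) t := by
  refine ((hasDerivAt_exp_I_mul t).mul (hasDerivAt_hankelSum n ht)).congr_deriv ?_
  rw [hankelDeriv]
  ring

/-- The Riccati-Bessel equation. -/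
theorem hasDerivAt_hankelDeriv (n : ℕ) {t : ℝ} (ht : t ≠ 0) :
    HasDerivAt (hankelDeriv n) (((n : ℂ) * (n + 1) / t ^ 2 - 1) * hankel n t) t := by
  have htc : (t : ℂ) ≠ 0 := by exact_mod_cast ht
  have h := (hasDerivAt_exp_I_mul t).mul (((hasDerivAt_hankelSum n ht).const_mul Complex.I).sub
    ((hasDerivAt_hankelEulerSum n ht).div (hasDerivAt_id (t : ℂ)).comp_ofReal htc))
  refine h.congr_deriv ?_
  have hr := hankelSum_recurrence n ht
  rw [hankel]
  simp only [id, Pi.sub_apply, Pi.div_apply]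
  have h2 : (n : ℂ) * (n + 1) / t ^ 2 * hankelSum n t = (∑ m ∈ Finset.range (n + 1),
      (m : ℂ) ^ 2 * (besselCoeff n m * (Complex.I / t) ^ m)
      + hankelEulerSum n t - 2 * Complex.I * t * hankelEulerSum n t) / t ^ 2 := by
    rw [hr]; ring
  rw [mul_left_comm, sub_mul, h2]
  generalize ∑ m ∈ Finset.range (n + 1), (m : ℂ) ^ 2 * (besselCoeff n m * (Complex.I / t) ^ m) = Q
  field_simp
  ring_nf
  rw [Complex.I_sq]
  ring

theorem tendsto_I_div_pow {m : ℕ} (hm : m ≠ 0) :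
    Tendsto (fun t : ℝ => (Complex.I / (t : ℂ)) ^ m) atTop (𝓝 0) := by
  have h : Tendsto (fun t : ℝ => Complex.I / (t : ℂ)) atTop (𝓝 0) := by
    rw [tendsto_zero_iff_norm_tendsto_zero]
    refine tendsto_inv_atTop_zero.congr' ?_
    filter_upwards [eventually_gt_atTop 0] with t ht
    simp [abs_of_pos ht]
  simpa [hm] using h.pow m

theorem tendsto_hankelSum (n : ℕ) : Tendsto (hankelSum n) atTop (𝓝 1) := by
  unfold hankelSum
  simp_rw [Finset.sum_range_succ']
  simp only [besselCoeff_zero, pow_zero, Complex.ofReal_one, mul_one]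
  simpa using (tendsto_finsetSum (Finset.range n) fun m _ =>
    (tendsto_I_div_pow m.succ_ne_zero).const_mul ((besselCoeff n (m + 1) : ℝ) : ℂ)).add_const 1

theorem tendsto_hankelEulerSum (n : ℕ) : Tendsto (hankelEulerSum n) atTop (𝓝 0) := by
  unfold hankelEulerSum
  simp_rw [Finset.sum_range_succ']
  simpa using tendsto_finsetSum (Finset.range n) fun m _ =>
    ((tendsto_I_div_pow m.succ_ne_zero).const_mul
      ((besselCoeff n (m + 1) : ℝ) : ℂ)).const_mul ((m + 1 : ℕ) : ℂ)

theorem tendsto_hankelEulerSum_div (n : ℕ) :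
    Tendsto (fun t => hankelEulerSum n t / t) atTop (𝓝 0) := by
  have h : Tendsto (fun t : ℝ => ((t⁻¹ : ℝ) : ℂ)) atTop (𝓝 0) := by
    exact_mod_cast (Complex.continuous_ofReal.tendsto 0).comp tendsto_inv_atTop_zero
  simpa [div_eq_mul_inv] using (tendsto_hankelEulerSum n).mul h

theorem norm_exp_I_mul (t : ℝ) : ‖Complex.exp (Complex.I * t)‖ = 1 := by
  rw [mul_comm, Complex.norm_exp_ofReal_mul_I]

/-! ### Majorants for the Riccati-Hankel functions. -/

theorem norm_hankelSum_le (n : ℕ) {t : ℝ} (ht : 0 < t) :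
    ‖hankelSum n t‖ ≤ Real.exp (n * (n + 1) / (2 * t)) := by
  refine (norm_sum_le _ _).trans (le_trans ?_
    (Real.sum_le_exp_of_nonneg (by positivity : 0 ≤ (n : ℝ) * (n + 1) / (2 * t)) (n + 1)))
  refine Finset.sum_le_sum fun m hm => ?_
  obtain ⟨h0, h1⟩ := besselCoeff_mem_Icc n (Nat.lt_succ_iff.1 (Finset.mem_range.1 hm))
  simp only [norm_mul, norm_pow, norm_div, Complex.norm_I, Complex.norm_real, Real.norm_eq_abs,
    abs_of_nonneg h0, abs_of_pos ht]
  calc besselCoeff n m * (1 / t) ^ m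
      ≤ ((n : ℝ) * (n + 1) / 2) ^ m / m.factorial * (1 / t) ^ m := by gcongr
    _ = _ := by
      rw [div_mul_eq_mul_div, ← mul_pow]
      congr 2
      field_simp

/-- The weight `m` cancels one factor of `m!`, so the majorising series is `q` times a partial sum
of `e^q`. -/
theorem norm_hankelEulerSum_le (n : ℕ) {t : ℝ} (ht : 0 < t) :
    ‖hankelEulerSum n t‖
      ≤ n * (n + 1) / (2 * t) * Real.exp (n * (n + 1) / (2 * t)) := by
  have hq : 0 ≤ (n : ℝ) * (n + 1) / (2 * t) := by positivity
  refine le_trans ?_ (mul_le_mul_of_nonneg_left (Real.sum_le_exp_of_nonneg hq n) hq)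
  rw [hankelEulerSum, Finset.sum_range_succ']
  simp only [Nat.cast_zero, zero_mul, add_zero]
  refine (norm_sum_le _ _).trans ?_
  rw [Finset.mul_sum]
  refine Finset.sum_le_sum fun m hm => ?_
  obtain ⟨h0, h1⟩ := besselCoeff_mem_Icc n (m := m + 1) (Finset.mem_range.1 hm)
  simp only [norm_mul, norm_pow, norm_div, Complex.norm_I, Complex.norm_real, Real.norm_eq_abs,
    abs_of_nonneg h0, abs_of_pos ht, Complex.norm_natCast]
  calc ((m + 1 : ℕ) : ℝ) * (besselCoeff n (m + 1) * (1 / t) ^ (m + 1))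
      ≤ ((m + 1 : ℕ) : ℝ) *
        (((n : ℝ) * (n + 1) / 2) ^ (m + 1) / (m + 1).factorial * (1 / t) ^ (m + 1)) := by gcongr
    _ = ((n : ℝ) * (n + 1) / 2 * (1 / t)) ^ (m + 1) / m.factorial := by
      rw [Nat.factorial_succ, mul_pow]
      push_cast
      field_simp
    _ = _ := by
      rw [pow_succ', show (n : ℝ) * (n + 1) / 2 * (1 / t) = n * (n + 1) / (2 * t) by field_simp]
      ring

/-- The combination estimated is `t` times the derivative of `hankel n t / t`, the radial factor of
an outgoing wave. -/
theorem norm_hankelDeriv_sub_le (n : ℕ) {t : ℝ} (ht : 0 < t) :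
    ‖hankelDeriv n t - hankel n t / t‖ ≤
      Real.exp (n * (n + 1) / (2 * t)) * (1 + (1 + n * (n + 1) / (2 * t)) / t) := by
  have h1 := norm_hankelSum_le n ht
  have h2 := norm_hankelEulerSum_le n ht
  have e : hankelDeriv n t - hankel n t / t = Complex.exp (Complex.I * t) *
      (Complex.I * hankelSum n t - hankelEulerSum n t / t - hankelSum n t / t) := by
    rw [hankelDeriv, hankel]; ring
  rw [e, norm_mul, norm_exp_I_mul, one_mul]
  refine (norm_sub_le _ _).trans ((add_le_add_left (norm_sub_le _ _) _).trans ?_)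
  simp only [norm_mul, norm_div, Complex.norm_I, one_mul, Complex.norm_real, Real.norm_eq_abs,
    abs_of_pos ht]
  set q := (n : ℝ) * (n + 1) / (2 * t)
  calc ‖hankelSum n t‖ + ‖hankelEulerSum n t‖ / t + ‖hankelSum n t‖ / t
      ≤ Real.exp q + q * Real.exp q / t + Real.exp q / t := by gcongr
    _ = _ := by ring

/-! ### Uniqueness for the Riccati-Bessel equation. -/

/-- Abel's identity for equations `y'' = p y`: the Wronskian of two solutions is constant. -/
theorem wronskian_eq_of_tendsto {R : ℝ} {p y y' z z' : ℝ → ℂ} {L : ℂ}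
    (hy : ∀ r > R, HasDerivAt y (y' r) r) (hy' : ∀ r > R, HasDerivAt y' (p r * y r) r)
    (hz : ∀ r > R, HasDerivAt z (z' r) r) (hz' : ∀ r > R, HasDerivAt z' (p r * z r) r)
    (hL : Tendsto (fun r => y r * z' r - y' r * z r) atTop (𝓝 L)) {r : ℝ} (hr : R < r) :
    y r * z' r - y' r * z r = L := by
  have hd : ∀ r > R, HasDerivAt (fun r => y r * z' r - y' r * z r) 0 r := fun r hr =>
    (((hy r hr).mul (hz' r hr)).sub ((hy' r hr).mul (hz r hr))).congr_deriv (by ring)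
  refine tendsto_nhds_unique (tendsto_const_nhds.congr' ?_) hL
  filter_upwards [eventually_gt_atTop R] with s hs
  exact isOpen_Ioi.is_const_of_deriv_eq_zero isPreconnected_Ioi
    (fun r hr => (hd r hr).differentiableAt.differentiableWithinAt)
    (fun r hr => (hd r hr).deriv) hr hs

/-- A solution of the Riccati-Bessel equation which tends to zero together with its derivative
vanishes. -/
theorem riccatiBessel_eq_zero {n : ℕ} {k R : ℝ} (hk : 0 < k) (hR : 0 ≤ R) {z z' : ℝ → ℂ}
    (hz : ∀ r > R, HasDerivAt z (z' r) r)
    (hz' : ∀ r > R, HasDerivAt z' (((n : ℂ) * (n + 1) / r ^ 2 - k ^ 2) * z r) r)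
    (h0 : Tendsto z atTop (𝓝 0)) (h0' : Tendsto z' atTop (𝓝 0)) {r : ℝ} (hr : R < r) :
    z r = 0 ∧ z' r = 0 := by
  have hkc : (k : ℂ) ≠ 0 := by exact_mod_cast hk.ne'
  set p : ℝ → ℂ := fun r => (n : ℂ) * (n + 1) / r ^ 2 - k ^ 2
  set y : ℝ → ℂ := fun r => hankel n (k * r)
  set y' : ℝ → ℂ := fun r => k * hankelDeriv n (k * r)
  have hlin : ∀ r : ℝ, HasDerivAt (fun r => k * r) k r := fun r => by
    simpa using (hasDerivAt_id r).const_mul k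
  have hy : ∀ r > R, HasDerivAt y (y' r) r := fun r hr => by
    have := (hasDerivAt_hankel n (mul_pos hk (hR.trans_lt hr)).ne').scomp r (hlin r)
    simpa [y', Function.comp_def] using this
  have hy' : ∀ r > R, HasDerivAt y' (p r * y r) r := fun r hr => by
    have hr0 : (r : ℂ) ≠ 0 := by exact_mod_cast (hR.trans_lt hr).ne'
    have := ((hasDerivAt_hankelDeriv n (mul_pos hk (hR.trans_lt hr)).ne').scomp r
      (hlin r)).const_mul (k : ℂ)
    refine this.congr_deriv ?_
    simp only [p, y, Complex.real_smul]
    push_cast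
    field_simp
  have hc : ∀ r > R, HasDerivAt (fun r => (starRingEnd ℂ) (y r)) ((starRingEnd ℂ) (y' r)) r :=
    fun r hr => (hy r hr).star
  have hc' : ∀ r > R, HasDerivAt (fun r => (starRingEnd ℂ) (y' r))
      (p r * (starRingEnd ℂ) (y r)) r := fun r hr => by
    refine (hy' r hr).star.congr_deriv ?_
    simp [p]
  have hkr : Tendsto (fun r : ℝ => k * r) atTop atTop := tendsto_id.const_mul_atTop hk
  -- behaviour at infinity, up to the phase factor
  have hS : Tendsto (fun r => hankelSum n (k * r)) atTop (𝓝 1) := (tendsto_hankelSum n).comp hkr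
  have hT : Tendsto (fun r => Complex.I * hankelSum n (k * r)
      - hankelEulerSum n (k * r) / ((k * r : ℝ) : ℂ)) atTop (𝓝 Complex.I) := by
    simpa using (hS.const_mul Complex.I).sub ((tendsto_hankelEulerSum_div n).comp hkr)
  have bdd : ∀ (f g : ℝ → ℂ) (l : ℂ), Tendsto f atTop (𝓝 l) → Tendsto g atTop (𝓝 0) →
      Tendsto (fun r => Complex.exp (Complex.I * ((k * r : ℝ) : ℂ)) * f r * g r) atTop (𝓝 0) := by
    intro f g l hf hg
    have := (hf.mul hg).norm
    rw [mul_zero, norm_zero] at this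
    rw [tendsto_zero_iff_norm_tendsto_zero]
    refine this.congr fun r => ?_
    rw [norm_mul, norm_mul, norm_mul, norm_exp_I_mul, one_mul]
  -- The functions `y` and `y'` stay bounded while `z` and `z'` tend to zero, so the Wronskian
  -- vanishes at infinity.
  have W1 : y r * z' r - y' r * z r = 0 := by
    refine wronskian_eq_of_tendsto hy hy' hz hz' ?_ hr
    have := (bdd _ _ _ hS h0').sub ((bdd _ _ _ hT h0).const_mul (k : ℂ))
    simp only [mul_zero, sub_zero] at this
    refine this.congr fun r => ?_
    simp only [y, y', hankel, hankelDeriv]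
    ring
  have W2 : (starRingEnd ℂ) (y r) * z' r - (starRingEnd ℂ) (y' r) * z r = 0 := by
    refine wronskian_eq_of_tendsto hc hc' hz hz' ?_ hr
    have hs : ∀ {f : ℝ → ℂ}, Tendsto f atTop (𝓝 0) →
        Tendsto (fun r => (starRingEnd ℂ) (f r)) atTop (𝓝 0) := fun {f} hf => by
      simpa only [Function.comp_def, map_zero] using (Complex.continuous_conj.tendsto 0).comp hf
    -- `bdd` carries the phase `e^{ikr}`, so the limit is taken for the conjugate expression and
    -- then conjugated back.
    have h1 := (bdd _ _ _ hS (hs h0')).sub ((bdd _ _ _ hT (hs h0)).const_mul (k : ℂ))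
    simp only [mul_zero, sub_zero] at h1
    have := hs h1
    refine this.congr fun r => ?_
    simp only [y, y', hankel, hankelDeriv, map_sub, map_mul, Complex.conj_conj]
    ring
  -- The phases cancel here. The nonzero constant shows that `y` and its conjugate are independent
  -- solutions.
  have W3 : y r * (starRingEnd ℂ) (y' r) - y' r * (starRingEnd ℂ) (y r) = -2 * Complex.I * k := by
    refine wronskian_eq_of_tendsto hy hy' hc hc' ?_ hr
    have hs : ∀ {f : ℝ → ℂ} {l : ℂ}, Tendsto f atTop (𝓝 l) →
        Tendsto (fun r => (starRingEnd ℂ) (f r)) atTop (𝓝 ((starRingEnd ℂ) l)) :=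
      fun {f l} hf => (Complex.continuous_conj.tendsto l).comp hf
    have := ((hS.mul (hs hT)).sub (hT.mul (hs hS))).const_mul (k : ℂ)
    have e : (k : ℂ) * (1 * (starRingEnd ℂ) Complex.I - Complex.I * (starRingEnd ℂ) 1)
        = -2 * Complex.I * k := by
      rw [Complex.conj_I, map_one]; ring
    rw [e] at this
    refine this.congr fun r => ?_
    have hE : Complex.exp (Complex.I * ((k * r : ℝ) : ℂ))
        * (starRingEnd ℂ) (Complex.exp (Complex.I * ((k * r : ℝ) : ℂ))) = 1 := by
      rw [Complex.mul_conj, Complex.normSq_eq_norm_sq, norm_exp_I_mul]; simp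
    simp only [y, y', hankel, hankelDeriv, map_mul, Complex.conj_ofReal]
    generalize (starRingEnd ℂ) (Complex.I * hankelSum n (k * r)
      - hankelEulerSum n (k * r) / ((k * r : ℝ) : ℂ)) = a
    linear_combination (-(k : ℂ) * (hankelSum n (k * r) * a - (Complex.I * hankelSum n (k * r)
      - hankelEulerSum n (k * r) / ((k * r : ℝ) : ℂ)) * (starRingEnd ℂ) (hankelSum n (k * r)))) * hE
  have hne : (-2 * Complex.I * k : ℂ) ≠ 0 := by simp [hkc]
  constructor
  -- Cramer's rule for the linear system `W1`, `W2` in `z r`, `z' r`, whose determinant is given by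
  -- `W3`.
  · refine (mul_eq_zero.1 ?_).resolve_left hne
    rw [← W3]
    linear_combination (starRingEnd ℂ) (y r) * W1 - y r * W2
  · refine (mul_eq_zero.1 ?_).resolve_left hne
    rw [← W3]
    linear_combination (starRingEnd ℂ) (y' r) * W1 - y' r * W2

/-- A solution of the Riccati-Bessel equation satisfying the radiation condition is determined by
its amplitude at infinity. -/
theorem riccatiBessel_eq_hankel {n : ℕ} {k R : ℝ} (hk : 0 < k) (hR : 0 ≤ R) {v v' : ℝ → ℂ} {a : ℂ}
    (hv : ∀ r > R, HasDerivAt v (v' r) r)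
    (hv' : ∀ r > R, HasDerivAt v' (((n : ℂ) * (n + 1) / r ^ 2 - k ^ 2) * v r) r)
    (hrad : Tendsto (fun r => v' r - Complex.I * k * v r) atTop (𝓝 0))
    (hamp : Tendsto (fun r : ℝ => v r - Complex.exp (Complex.I * k * r) * a) atTop (𝓝 0))
    {r : ℝ} (hr : R < r) :
    v r = a * hankel n (k * r) ∧ v' r = a * (k * hankelDeriv n (k * r)) := by
  have hkr : Tendsto (fun r : ℝ => k * r) atTop atTop := tendsto_id.const_mul_atTop hk
  have hlin : ∀ r : ℝ, HasDerivAt (fun r => k * r) k r := fun r => by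
    simpa using (hasDerivAt_id r).const_mul k
  -- The difference from the candidate solves the same equation, and it tends to zero with its
  -- derivative: `h0` comes from the amplitude, `h0'` from the radiation condition.
  have hz : ∀ r > R, HasDerivAt (fun r => v r - a * hankel n (k * r))
      (v' r - a * (k * hankelDeriv n (k * r))) r := fun r hr => by
    have := ((hasDerivAt_hankel n (mul_pos hk (hR.trans_lt hr)).ne').scomp r
      (hlin r)).const_mul a
    exact (hv r hr).sub (by simpa [Function.comp_def] using this)
  have hz' : ∀ r > R, HasDerivAt (fun r => v' r - a * (k * hankelDeriv n (k * r)))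
      (((n : ℂ) * (n + 1) / r ^ 2 - k ^ 2) * (v r - a * hankel n (k * r))) r := fun r hr => by
    have hr0 : (r : ℂ) ≠ 0 := by exact_mod_cast (hR.trans_lt hr).ne'
    have hkc : (k : ℂ) ≠ 0 := by exact_mod_cast hk.ne'
    have := (((hasDerivAt_hankelDeriv n (mul_pos hk (hR.trans_lt hr)).ne').scomp r
      (hlin r)).const_mul (k : ℂ)).const_mul a
    refine ((hv' r hr).sub this).congr_deriv ?_
    rw [Complex.real_smul]
    push_cast
    field_simp
  have phase : ∀ {f : ℝ → ℂ}, Tendsto f atTop (𝓝 0) →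
      Tendsto (fun r => Complex.exp (Complex.I * ((k * r : ℝ) : ℂ)) * f r) atTop (𝓝 0) := by
    intro f hf
    rw [tendsto_zero_iff_norm_tendsto_zero] at hf ⊢
    exact hf.congr fun r => by rw [norm_mul, norm_exp_I_mul, one_mul]
  have h0 : Tendsto (fun r => v r - a * hankel n (k * r)) atTop (𝓝 0) := by
    have h1 : Tendsto (fun r => a * (1 - hankelSum n (k * r))) atTop (𝓝 0) := by
      simpa using (((tendsto_hankelSum n).comp hkr).const_sub 1).const_mul a
    have := hamp.add (phase h1)
    rw [add_zero] at this
    refine this.congr fun r => ?_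
    rw [hankel]
    push_cast
    ring_nf
  have h0' : Tendsto (fun r => v' r - a * (k * hankelDeriv n (k * r))) atTop (𝓝 0) := by
    have h1 : Tendsto (fun r : ℝ => a * k * (hankelEulerSum n (k * r) / ((k * r : ℝ) : ℂ)))
        atTop (𝓝 0) := by
      simpa using ((tendsto_hankelEulerSum_div n).comp hkr).const_mul (a * k)
    have := (hrad.add (h0.const_mul (Complex.I * k))).add (phase h1)
    simp only [mul_zero, add_zero] at this
    refine this.congr fun r => ?_
    rw [hankel, hankelDeriv]
    ring
  obtain ⟨e1, e2⟩ := riccatiBessel_eq_zero hk hR hz hz' h0 h0' hr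
  exact ⟨sub_eq_zero.1 e1, sub_eq_zero.1 e2⟩

/-! ### Rotations and integration over the sphere. -/

instance : IsFiniteMeasure surfaceMeasure := by
  unfold surfaceMeasure
  infer_instance

/-- A derivative may be taken under an integral over the unit sphere. -/
theorem hasDerivAt_integral_sphere {F F' : ℝ → Sphere2 → ℂ} {s : Set ℝ} (hs : IsOpen s)
    (hF : ∀ r ∈ s, Continuous (F r))
    (hF' : ContinuousOn (fun q : ℝ × Sphere2 => F' q.1 q.2) (s ×ˢ Set.univ))
    (hd : ∀ r ∈ s, ∀ σ, HasDerivAt (fun r => F r σ) (F' r σ) r) {r : ℝ} (hr : r ∈ s) :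
    HasDerivAt (fun r => ∫ σ, F r σ ∂surfaceMeasure) (∫ σ, F' r σ ∂surfaceMeasure) r := by
  -- Compactness of a closed interval times the sphere bounds `F'` by a constant, which serves as
  -- the dominating function.
  obtain ⟨δ, hδ, hsub⟩ := Metric.nhds_basis_closedBall.mem_iff.1 (hs.mem_nhds hr)
  obtain ⟨C, hC⟩ := ((isCompact_closedBall r δ).prod (isCompact_univ (X := Sphere2)))
    |>.exists_bound_of_continuousOn (hF'.mono (Set.prod_mono hsub subset_rfl))
  have hF'r : Continuous (F' r) := by
    rw [← continuousOn_univ]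
    exact hF'.comp (f := fun σ => (r, σ)) (by fun_prop) fun σ _ => ⟨hr, trivial⟩
  refine (hasDerivAt_integral_of_dominated_loc_of_deriv_le (bound := fun _ => C)
    (Metric.closedBall_mem_nhds r hδ) ?_ ?_ hF'r.aestronglyMeasurable ?_ (integrable_const C) ?_).2
  · filter_upwards [hs.mem_nhds hr] with x hx using (hF x hx).aestronglyMeasurable
  · exact (hF r hr).integrable_of_hasCompactSupport (HasCompactSupport.of_compactSpace _)
  · exact Eventually.of_forall fun σ x hx => hC (x, σ) ⟨hx, trivial⟩
  · exact Eventually.of_forall fun σ x hx => hd x (hsub hx) σ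

/-- A linear isometry acts on the unit sphere. -/
noncomputable def sphereMap (ρ : Space3 ≃ₗᵢ[ℝ] Space3) (σ : Sphere2) : Sphere2 :=
  ⟨ρ σ, by simp⟩

theorem continuous_sphereMap (ρ : Space3 ≃ₗᵢ[ℝ] Space3) : Continuous (sphereMap ρ) :=
  (ρ.continuous.comp continuous_subtype_val).subtype_mk _

-- The surface measure of `s` is a multiple of the volume of the cone `(0,1) • s`, and a linear
-- isometry preserves volume.
open scoped Pointwise in
theorem measurePreserving_sphereMap (ρ : Space3 ≃ₗᵢ[ℝ] Space3) :
    MeasurePreserving (sphereMap ρ) surfaceMeasure surfaceMeasure := by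
  have hm : Measurable (sphereMap ρ) := (continuous_sphereMap ρ).measurable
  refine ⟨hm, Measure.ext fun s hs => ?_⟩
  rw [Measure.map_apply hm hs, surfaceMeasure, Measure.toSphere_apply' _ hs,
    Measure.toSphere_apply' _ (hm hs)]
  congr 1
  have e : Set.Ioo (0 : ℝ) 1 • ((↑) '' (sphereMap ρ ⁻¹' s) : Set Space3)
      = ρ ⁻¹' (Set.Ioo (0 : ℝ) 1 • ((↑) '' s : Set Space3)) := by
    ext x
    simp only [Set.mem_smul, Set.mem_image, Set.mem_preimage]
    constructor
    · rintro ⟨t, ht, _, ⟨σ, hσ, rfl⟩, rfl⟩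
      exact ⟨t, ht, _, ⟨_, hσ, rfl⟩, by simp [sphereMap]⟩
    · rintro ⟨t, ht, _, ⟨σ, hσ, rfl⟩, hx⟩
      refine ⟨t, ht, _, ⟨sphereMap ρ.symm σ, ?_, rfl⟩, ?_⟩
      · have : sphereMap ρ (sphereMap ρ.symm σ) = σ := Subtype.ext (by simp [sphereMap])
        rwa [this]
      · rw [← ρ.symm_apply_apply x, ← hx]; simp [sphereMap]
  rw [e]
  exact ρ.measurePreserving.measure_preimage_emb
    ρ.toHomeomorph.measurableEmbedding _

/-- The standard basis vectors of `Space3`. -/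
noncomputable abbrev stdVec (i : Fin 3) : Space3 := EuclideanSpace.single i (1 : ℝ)

/-- The generator `x ↦ e_i × x` of the rotations about the `i`-th coordinate axis. -/
noncomputable def rotGen (i : Fin 3) : Space3 →L[ℝ] Space3 :=
  (EuclideanSpace.proj (i + 1) : Space3 →L[ℝ] ℝ).smulRight (stdVec (i + 2))
    - (EuclideanSpace.proj (i + 2) : Space3 →L[ℝ] ℝ).smulRight (stdVec (i + 1))

theorem rotGen_apply (i : Fin 3) (x : Space3) :
    rotGen i x = x (i + 1) • stdVec (i + 2) - x (i + 2) • stdVec (i + 1) := by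
  simp [rotGen]

/-- With `J = rotGen i`, the relation `J³ = -J` makes `1 + sin θ J + (1 - cos θ) J²` (Rodrigues'
formula) equal to `exp(θJ)`; it is what `hasDerivAt_rot` needs. -/
theorem rotGen_cube (i : Fin 3) (x : Space3) : rotGen i (rotGen i (rotGen i x)) = -rotGen i x := by
  ext j
  fin_cases i <;> fin_cases j <;> simp [rotGen_apply]

/-- The first-order term `2 r w'` of the spherical Bessel equation comes from this factor `-2`. -/
theorem sum_rotGen_sq (x : Space3) : ∑ i, rotGen i (rotGen i x) = (-2 : ℝ) • x := by
  ext j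
  fin_cases j <;> simp [rotGen_apply, Fin.sum_univ_three] <;> ring

/-- The rotation by the angle `θ` about the `i`-th coordinate axis, as a linear map. -/
noncomputable def rotLin (i : Fin 3) (θ : ℝ) : Space3 →L[ℝ] Space3 :=
  ContinuousLinearMap.id ℝ Space3 + Real.sin θ • rotGen i
    + (1 - Real.cos θ) • (rotGen i).comp (rotGen i)

theorem rotLin_apply (i : Fin 3) (θ : ℝ) (x : Space3) :
    rotLin i θ x = x + Real.sin θ • rotGen i x + (1 - Real.cos θ) • rotGen i (rotGen i x) := rfl

theorem norm_rotLin (i : Fin 3) (θ : ℝ) (x : Space3) : ‖rotLin i θ x‖ = ‖x‖ := by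
  rw [← sq_eq_sq₀ (norm_nonneg _) (norm_nonneg _), EuclideanSpace.real_norm_sq_eq,
    EuclideanSpace.real_norm_sq_eq, Fin.sum_univ_three, Fin.sum_univ_three]
  have h := Real.sin_sq_add_cos_sq θ
  fin_cases i <;> simp [rotLin_apply, rotGen_apply]
  · linear_combination ((x 1) ^ 2 + (x 2) ^ 2) * h
  · linear_combination ((x 0) ^ 2 + (x 2) ^ 2) * h
  · linear_combination ((x 0) ^ 2 + (x 1) ^ 2) * h

/-- The rotation by the angle `θ` about the `i`-th coordinate axis. -/
noncomputable def rot (i : Fin 3) (θ : ℝ) : Space3 ≃ₗᵢ[ℝ] Space3 :=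
  LinearIsometry.toLinearIsometryEquiv ⟨(rotLin i θ).toLinearMap, norm_rotLin i θ⟩ rfl

theorem rot_apply (i : Fin 3) (θ : ℝ) (x : Space3) :
    rot i θ x = x + Real.sin θ • rotGen i x + (1 - Real.cos θ) • rotGen i (rotGen i x) := rfl

theorem hasDerivAt_rot (i : Fin 3) (x : Space3) (θ : ℝ) :
    HasDerivAt (fun θ => rot i θ x) (rotGen i (rot i θ x)) θ := by
  have h := (((Real.hasDerivAt_sin θ).smul_const (rotGen i x)).const_add x).add
    (((Real.hasDerivAt_cos θ).const_sub 1).smul_const (rotGen i (rotGen i x)))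
  refine h.congr_deriv ?_
  simp only [rot_apply, map_add, map_smul, rotGen_cube, neg_neg]
  module

theorem continuous_sphereMap_rot (i : Fin 3) :
    Continuous fun q : ℝ × Sphere2 => sphereMap (rot i q.1) q.2 := by
  refine Continuous.subtype_mk ?_ _
  simp only [rot_apply]
  fun_prop

/-- The derivative of a function along the rotations about an axis has mean value zero over the
sphere. -/
theorem integral_rotation_deriv_eq_zero (i : Fin 3) {F G : Sphere2 → ℂ} (hF : Continuous F)
    (hG : Continuous G)
    (hd : ∀ θ σ, HasDerivAt (fun θ => F (sphereMap (rot i θ) σ)) (G (sphereMap (rot i θ) σ)) θ) :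
    ∫ σ, G σ ∂surfaceMeasure = 0 := by
  have h := hasDerivAt_integral_sphere (F := fun θ σ => F (sphereMap (rot i θ) σ))
    (F' := fun θ σ => G (sphereMap (rot i θ) σ)) isOpen_univ
    (fun θ _ => hF.comp (continuous_sphereMap _))
    (hG.comp (continuous_sphereMap_rot i)).continuousOn (fun θ _ σ => hd θ σ) (Set.mem_univ 0)
  have hinv : ∀ {H : Sphere2 → ℂ}, Continuous H → ∀ θ,
      ∫ σ, H (sphereMap (rot i θ) σ) ∂surfaceMeasure = ∫ σ, H σ ∂surfaceMeasure := by
    intro H hH θ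
    have hp := measurePreserving_sphereMap (rot i θ)
    conv_rhs => rw [← hp.map_eq]
    exact (integral_map hp.measurable.aemeasurable hH.aestronglyMeasurable).symm
  -- By invariance of the measure the integral of `F` does not depend on `θ`, so its derivative is
  -- zero.
  simp only [hinv hF, hinv hG] at h
  exact h.unique (hasDerivAt_const _ _)

/-! ### Harmonic polynomials and the angular Laplacian. -/

/-- A complex polynomial as a function on `Space3`. -/
noncomputable def polyFun (p : MvPolynomial (Fin 3) ℂ) (x : Space3) : ℂ :=
  MvPolynomial.eval (fun i => ((x i : ℝ) : ℂ)) p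

theorem continuous_polyFun (p : MvPolynomial (Fin 3) ℂ) : Continuous (polyFun p) :=
  (MvPolynomial.continuous_eval p).comp (by fun_prop)

theorem hasDerivAt_polyFun (p : MvPolynomial (Fin 3) ℂ) {γ : ℝ → Space3} {γ' : Space3} {θ : ℝ}
    (hγ : HasDerivAt γ γ' θ) :
    HasDerivAt (fun θ => polyFun p (γ θ))
      (∑ j, (γ' j : ℂ) * polyFun (MvPolynomial.pderiv j p) (γ θ)) θ := by
  induction p using MvPolynomial.induction_on with
  | C a => simpa [polyFun] using hasDerivAt_const θ a
  | add p q hp hq =>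
    refine ((hp.add hq).congr_deriv ?_).congr_of_eventuallyEq
      (Eventually.of_forall fun θ => by simp [polyFun])
    simp only [polyFun, map_add, mul_add, Finset.sum_add_distrib]
  | mul_X p i hp =>
    have hi : HasDerivAt (fun θ => ((γ θ i : ℝ) : ℂ)) (γ' i : ℂ) θ :=
      ((EuclideanSpace.proj i : Space3 →L[ℝ] ℝ).hasFDerivAt.comp_hasDerivAt θ hγ).ofReal_comp
    refine ((hp.mul hi).congr_deriv ?_).congr_of_eventuallyEq
      (Eventually.of_forall fun θ => by simp [polyFun])
    have : ∀ j, (γ' j : ℂ) * polyFun (MvPolynomial.pderiv j (p * MvPolynomial.X i)) (γ θ)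
        = (γ' j : ℂ) * polyFun (MvPolynomial.pderiv j p) (γ θ) * (γ θ i : ℝ)
          + if j = i then (γ' j : ℂ) * polyFun p (γ θ) else 0 := by
      intro j
      rcases eq_or_ne j i with rfl | h
      · simp [polyFun]
        ring
      · simp [polyFun, h, MvPolynomial.pderiv_X_of_ne h.symm]
        ring
    simp only [this, Finset.sum_add_distrib, Finset.sum_mul, Finset.sum_ite_eq',
      Finset.mem_univ, if_true]
    ring

/-- The derivative of a polynomial along the rotations about the `i`-th axis. -/
noncomputable def polyRot (i : Fin 3) (p : MvPolynomial (Fin 3) ℂ) : MvPolynomial (Fin 3) ℂ :=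
  MvPolynomial.X (i + 1) * MvPolynomial.pderiv (i + 2) p
    - MvPolynomial.X (i + 2) * MvPolynomial.pderiv (i + 1) p

theorem hasDerivAt_polyFun_rot (p : MvPolynomial (Fin 3) ℂ) (i : Fin 3) (x : Space3) (θ : ℝ) :
    HasDerivAt (fun θ => polyFun p (rot i θ x)) (polyFun (polyRot i p) (rot i θ x)) θ := by
  refine (hasDerivAt_polyFun p (hasDerivAt_rot i x θ)).congr_deriv ?_
  generalize rot i θ x = y
  fin_cases i <;> simp [polyFun, polyRot, rotGen_apply, Fin.sum_univ_three] <;> ring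

/-- The commutator of two derivations is a derivation, so it suffices that it kills the variables.
-/
theorem pderiv_pderiv_comm (i j : Fin 3) (p : MvPolynomial (Fin 3) ℂ) :
    MvPolynomial.pderiv i (MvPolynomial.pderiv j p)
      = MvPolynomial.pderiv j (MvPolynomial.pderiv i p) := by
  have h : ⁅MvPolynomial.pderiv (R := ℂ) i, MvPolynomial.pderiv (R := ℂ) j⁆ = 0 := by
    refine MvPolynomial.derivation_ext (R := ℂ) fun l => ?_
    rw [Derivation.commutator_apply]
    simp only [MvPolynomial.pderiv_X, Pi.single_apply]
    split_ifs <;> simp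
  have := congrArg (fun D => D p) h
  rw [Derivation.commutator_apply] at this
  exact sub_eq_zero.1 this

/-- Homogeneous harmonic polynomials are eigenfunctions of the angular Laplacian. -/
theorem sum_polyRot_polyRot {n : ℕ} {p : MvPolynomial (Fin 3) ℂ} (hp : p.IsHomogeneous n)
    (hharm : ∑ i, MvPolynomial.pderiv i (MvPolynomial.pderiv i p) = 0) :
    ∑ i, polyRot i (polyRot i p) = -((n : MvPolynomial (Fin 3) ℂ) * (n + 1)) * p := by
  have hE := hp.sum_X_mul_pderiv
  rw [nsmul_eq_mul] at hE
  -- With `L_i = polyRot i` and the Euler operator `𝓔`, the identity behind the proof is `∑ L_i² =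
  -- |x|² Δ - 𝓔² - 𝓔`. Here `𝓔² p = n² p`.
  have hE2 : ∑ i, MvPolynomial.X i * MvPolynomial.pderiv i
      (∑ j, MvPolynomial.X j * MvPolynomial.pderiv j p) = (n : MvPolynomial (Fin 3) ℂ) ^ 2 * p := by
    simp only [hE, Derivation.leibniz, Derivation.map_natCast, smul_eq_mul]
    rw [sq, mul_assoc, ← hE, Finset.mul_sum]
    exact Finset.sum_congr rfl fun i _ => by ring
  simp only [Fin.sum_univ_three, polyRot, map_add, map_sub, Derivation.leibniz, smul_eq_mul,
    MvPolynomial.pderiv_X, Pi.single_apply, Fin.isValue, Fin.reduceAdd, Fin.reduceEq, if_true,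
    if_false] at hE hE2 hharm ⊢
  simp only [pderiv_pderiv_comm 1 0, pderiv_pderiv_comm 2 0, pderiv_pderiv_comm 2 1,
    Fin.isValue] at hE hE2 ⊢
  linear_combination (MvPolynomial.X 0 ^ 2 + MvPolynomial.X 1 ^ 2 + MvPolynomial.X 2 ^ 2) * hharm
    - hE2 - hE

/-! ### The spherical Bessel equation for the moments of an exterior solution. -/

theorem isOpen_norm_gt (R : ℝ) : IsOpen {x : Space3 | R < ‖x‖} :=
  isOpen_lt continuous_const continuous_norm

theorem smul_sphere_mem {R r : ℝ} (hR : 0 ≤ R) (hr : R < r) (σ : Sphere2) :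
    r • (σ : Space3) ∈ {x : Space3 | R < ‖x‖} := by
  simpa [norm_smul, abs_of_pos (hR.trans_lt hr)] using hr

theorem sphere_coord_sq (σ : Sphere2) :
    (σ : Space3) 0 ^ 2 + (σ : Space3) 1 ^ 2 + (σ : Space3) 2 ^ 2 = 1 := by
  have h := EuclideanSpace.real_norm_sq_eq (σ : Space3)
  rw [Fin.sum_univ_three] at h
  rw [← h]
  simp

theorem eq_sum_stdVec (x : Space3) : x = x 0 • stdVec 0 + x 1 • stdVec 1 + x 2 • stdVec 2 := by
  ext j
  fin_cases j <;> simp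

/-- The trace of a bilinear form, split into its radial and its angular part. -/
theorem sum_bilin_rotGen (B : Space3 →L[ℝ] Space3 →L[ℝ] ℂ) (σ : Sphere2) :
    ∑ i, B (rotGen i σ) (rotGen i σ) + B σ σ = ∑ i, B (stdVec i) (stdVec i) := by
  -- The tensor identity is `∑ J_i σ ⊗ J_i σ + σ ⊗ σ = |σ|² 1` with `J_i = rotGen i`; no symmetry of
  -- `B` is involved.
  have h : (((σ : Space3) 0 : ℝ) : ℂ) ^ 2 + (((σ : Space3) 1 : ℝ) : ℂ) ^ 2
      + (((σ : Space3) 2 : ℝ) : ℂ) ^ 2 = 1 := by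
    have := congrArg Complex.ofReal (sphere_coord_sq σ)
    simpa only [Complex.ofReal_add, Complex.ofReal_pow, Complex.ofReal_one] using this
  have e : B σ σ = B ((σ : Space3) 0 • stdVec 0 + (σ : Space3) 1 • stdVec 1
      + (σ : Space3) 2 • stdVec 2) ((σ : Space3) 0 • stdVec 0 + (σ : Space3) 1 • stdVec 1
      + (σ : Space3) 2 • stdVec 2) := by rw [← eq_sum_stdVec]
  rw [e]
  simp only [Fin.sum_univ_three, rotGen_apply, map_add, map_sub, map_smul,
    add_apply, sub_apply, smul_apply,
    Complex.real_smul, Fin.isValue, Fin.reduceAdd]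
  linear_combination (B (stdVec 0) (stdVec 0) + B (stdVec 1) (stdVec 1)
    + B (stdVec 2) (stdVec 2)) * h

theorem laplacian_eq_sum_stdVec (u : Space3 → ℂ) (x : Space3) :
    Laplacian.laplacian u x = ∑ i, fderiv ℝ (fderiv ℝ u) x (stdVec i) (stdVec i) := by
  rw [InnerProductSpace.laplacian_eq_iteratedFDeriv_orthonormalBasis u
    (EuclideanSpace.basisFun (Fin 3) ℝ)]
  simp [iteratedFDeriv_two_apply]

section Exterior

variable {R : ℝ} {u : Space3 → ℂ}

theorem hasFDerivAt_of_contDiffOn (hu : ContDiffOn ℝ 2 u {x | R < ‖x‖}) {x : Space3}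
    (hx : x ∈ {x : Space3 | R < ‖x‖}) : HasFDerivAt u (fderiv ℝ u x) x :=
  ((hu.contDiffAt ((isOpen_norm_gt R).mem_nhds hx)).differentiableAt (by norm_num)).hasFDerivAt

theorem contDiffOn_fderiv (hu : ContDiffOn ℝ 2 u {x | R < ‖x‖}) :
    ContDiffOn ℝ 1 (fderiv ℝ u) {x | R < ‖x‖} :=
  hu.fderiv_of_isOpen (isOpen_norm_gt R) (by norm_num)

theorem hasFDerivAt_fderiv_of_contDiffOn (hu : ContDiffOn ℝ 2 u {x | R < ‖x‖}) {x : Space3}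
    (hx : x ∈ {x : Space3 | R < ‖x‖}) :
    HasFDerivAt (fderiv ℝ u) (fderiv ℝ (fderiv ℝ u) x) x :=
  (((contDiffOn_fderiv hu).contDiffAt ((isOpen_norm_gt R).mem_nhds hx)).differentiableAt
    (by norm_num)).hasFDerivAt

theorem hasDerivAt_comp_curve (hu : ContDiffOn ℝ 2 u {x | R < ‖x‖}) {γ : ℝ → Space3}
    {γ' : Space3} {θ : ℝ} (hx : γ θ ∈ {x : Space3 | R < ‖x‖}) (hγ : HasDerivAt γ γ' θ) :
    HasDerivAt (fun θ => u (γ θ)) (fderiv ℝ u (γ θ) γ') θ :=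
  (hasFDerivAt_of_contDiffOn hu hx).comp_hasDerivAt θ hγ

theorem hasDerivAt_fderiv_comp_curve (hu : ContDiffOn ℝ 2 u {x | R < ‖x‖}) {γ γ₁ : ℝ → Space3}
    {γ' γ₁' : Space3} {θ : ℝ} (hx : γ θ ∈ {x : Space3 | R < ‖x‖}) (hγ : HasDerivAt γ γ' θ)
    (hγ₁ : HasDerivAt γ₁ γ₁' θ) :
    HasDerivAt (fun θ => fderiv ℝ u (γ θ) (γ₁ θ))
      (fderiv ℝ (fderiv ℝ u) (γ θ) γ' (γ₁ θ) + fderiv ℝ u (γ θ) γ₁') θ := by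
  have h : HasDerivAt (fun θ => fderiv ℝ u (γ θ)) (fderiv ℝ (fderiv ℝ u) (γ θ) γ') θ :=
    (hasFDerivAt_fderiv_of_contDiffOn hu hx).comp_hasDerivAt θ hγ
  exact h.clm_apply hγ₁

theorem continuousOn_fderiv_fderiv (hu : ContDiffOn ℝ 2 u {x | R < ‖x‖}) :
    ContinuousOn (fderiv ℝ (fderiv ℝ u)) {x | R < ‖x‖} :=
  ((contDiffOn_fderiv hu).fderiv_of_isOpen (m := 0) (isOpen_norm_gt R) (by norm_num)).continuousOn

theorem continuousOn_comp_smul_sphere {X : Type*} [TopologicalSpace X] (hR : 0 ≤ R)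
    {f : Space3 → X} (hf : ContinuousOn f {x | R < ‖x‖}) :
    ContinuousOn (fun q : ℝ × Sphere2 => f (q.1 • (q.2 : Space3))) (Set.Ioi R ×ˢ Set.univ) :=
  hf.comp (by fun_prop) fun q hq => smul_sphere_mem hR hq.1 q.2

theorem continuous_comp_smul_sphere {X : Type*} [TopologicalSpace X] (hR : 0 ≤ R)
    {f : Space3 → X} (hf : ContinuousOn f {x | R < ‖x‖}) {r : ℝ} (hr : R < r) :
    Continuous fun σ : Sphere2 => f (r • (σ : Space3)) :=
  hf.comp_continuous (by fun_prop) (smul_sphere_mem hR hr)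

theorem integrable_sphere {f : Sphere2 → ℂ} (hf : Continuous f) :
    Integrable f surfaceMeasure :=
  hf.integrable_of_hasCompactSupport (HasCompactSupport.of_compactSpace _)

/-- Green's identity for one of the angular momentum operators on the sphere. -/
theorem integral_angular_green (hR : 0 ≤ R) (hu : ContDiffOn ℝ 2 u {x | R < ‖x‖})
    (p : MvPolynomial (Fin 3) ℂ) (i : Fin 3) {r : ℝ} (hr : R < r) :
    ∫ σ : Sphere2, (fderiv ℝ (fderiv ℝ u) (r • (σ : Space3)) (r • rotGen i σ) (r • rotGen i σ)
        + fderiv ℝ u (r • (σ : Space3)) (r • rotGen i (rotGen i σ)))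
          * (starRingEnd ℂ) (polyFun p σ)
      - u (r • (σ : Space3)) * (starRingEnd ℂ) (polyFun (polyRot i (polyRot i p)) σ)
      ∂surfaceMeasure = 0 := by
  have c0 := continuous_comp_smul_sphere hR hu.continuousOn hr
  have c1 := continuous_comp_smul_sphere hR (contDiffOn_fderiv hu).continuousOn hr
  have c2 := continuous_comp_smul_sphere hR (continuousOn_fderiv_fderiv hu) hr
  have cp : ∀ p : MvPolynomial (Fin 3) ℂ,
      Continuous fun σ : Sphere2 => (starRingEnd ℂ) (polyFun p σ) := fun p =>
    Complex.continuous_conj.comp ((continuous_polyFun p).comp continuous_subtype_val)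
  have cJ : Continuous fun σ : Sphere2 => r • rotGen i (σ : Space3) := by fun_prop
  have cJ2 : Continuous fun σ : Sphere2 => r • rotGen i (rotGen i (σ : Space3)) := by fun_prop
  -- With `L` the derivative along the rotations, `F = (Lu) p̄ - u (Lp̄)`. The mixed terms cancel in
  -- `LF`, leaving `(L²u) p̄ - u (L²p̄)`.
  refine integral_rotation_deriv_eq_zero i
    (F := fun σ => fderiv ℝ u (r • (σ : Space3)) (r • rotGen i σ) * (starRingEnd ℂ) (polyFun p σ)
      - u (r • (σ : Space3)) * (starRingEnd ℂ) (polyFun (polyRot i p) σ))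
    (((c1.clm_apply cJ).mul (cp _)).sub (c0.mul (cp _)))
    (((((c2.clm_apply cJ).clm_apply cJ).add (c1.clm_apply cJ2)).mul (cp _)).sub (c0.mul (cp _)))
    fun θ σ => ?_
  have hx := smul_sphere_mem hR hr (sphereMap (rot i θ) σ)
  have hγ : HasDerivAt (fun θ => r • (sphereMap (rot i θ) σ : Space3))
      (r • rotGen i (sphereMap (rot i θ) σ)) θ := (hasDerivAt_rot i (σ : Space3) θ).const_smul r
  have hJ : HasDerivAt (fun θ => r • rotGen i (sphereMap (rot i θ) σ))
      (r • rotGen i (rotGen i (sphereMap (rot i θ) σ))) θ :=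
    ((rotGen i).hasFDerivAt.comp_hasDerivAt θ (hasDerivAt_rot i (σ : Space3) θ)).const_smul r
  have hp : ∀ p, HasDerivAt
      (fun θ => (starRingEnd ℂ) (polyFun p (sphereMap (rot i θ) σ)))
      ((starRingEnd ℂ) (polyFun (polyRot i p) (sphereMap (rot i θ) σ))) θ := fun p =>
    (hasDerivAt_polyFun_rot p i (σ : Space3) θ).star
  have h0 := hasDerivAt_comp_curve hu (γ := fun θ => r • (sphereMap (rot i θ) σ : Space3)) hx hγ
  have h1 := hasDerivAt_fderiv_comp_curve hu
    (γ := fun θ => r • (sphereMap (rot i θ) σ : Space3)) hx hγ hJ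
  refine ((h1.mul (hp p)).sub (h0.mul (hp (polyRot i p)))).congr_deriv ?_
  ring

/-- The moments of a solution of the Helmholtz equation against a spherical harmonic solve the
spherical Bessel equation. -/
theorem integral_spherical_bessel {k : ℝ} (hR : 0 ≤ R) (hu : ContDiffOn ℝ 2 u {x | R < ‖x‖})
    (hH : ∀ x ∈ {x : Space3 | R < ‖x‖}, Laplacian.laplacian u x + (k : ℂ) ^ 2 * u x = 0)
    {n : ℕ} {p : MvPolynomial (Fin 3) ℂ} (hp : p.IsHomogeneous n)
    (hharm : ∑ i, MvPolynomial.pderiv i (MvPolynomial.pderiv i p) = 0) {r : ℝ} (hr : R < r) :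
    (r : ℂ) ^ 2 * ∫ σ : Sphere2, fderiv ℝ (fderiv ℝ u) (r • (σ : Space3)) σ σ
        * (starRingEnd ℂ) (polyFun p σ) ∂surfaceMeasure
      + 2 * r * ∫ σ : Sphere2, fderiv ℝ u (r • (σ : Space3)) σ
        * (starRingEnd ℂ) (polyFun p σ) ∂surfaceMeasure
      + ((k : ℂ) ^ 2 * r ^ 2 - n * (n + 1)) * ∫ σ : Sphere2, u (r • (σ : Space3))
        * (starRingEnd ℂ) (polyFun p σ) ∂surfaceMeasure = 0 := by
  have c0 := continuous_comp_smul_sphere hR hu.continuousOn hr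
  have c1 := continuous_comp_smul_sphere hR (contDiffOn_fderiv hu).continuousOn hr
  have c2 := continuous_comp_smul_sphere hR (continuousOn_fderiv_fderiv hu) hr
  have cp : ∀ p : MvPolynomial (Fin 3) ℂ,
      Continuous fun σ : Sphere2 => (starRingEnd ℂ) (polyFun p σ) := fun p =>
    Complex.continuous_conj.comp ((continuous_polyFun p).comp continuous_subtype_val)
  have cJ : ∀ i, Continuous fun σ : Sphere2 => r • rotGen i (σ : Space3) := fun i => by fun_prop
  have cJ2 : ∀ i, Continuous fun σ : Sphere2 => r • rotGen i (rotGen i (σ : Space3)) :=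
    fun i => by fun_prop
  have cσ : Continuous fun σ : Sphere2 => (σ : Space3) := continuous_subtype_val
  have hsum : ∫ σ : Sphere2, ∑ i, ((fderiv ℝ (fderiv ℝ u) (r • (σ : Space3)) (r • rotGen i σ)
        (r • rotGen i σ) + fderiv ℝ u (r • (σ : Space3)) (r • rotGen i (rotGen i σ)))
          * (starRingEnd ℂ) (polyFun p σ)
      - u (r • (σ : Space3)) * (starRingEnd ℂ) (polyFun (polyRot i (polyRot i p)) σ))
      ∂surfaceMeasure = 0 := by
    rw [integral_finsetSum]
    · exact Finset.sum_eq_zero fun i _ => integral_angular_green hR hu p i hr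
    · refine fun i _ => integrable_sphere ?_
      exact ((((c2.clm_apply (cJ i)).clm_apply (cJ i)).add (c1.clm_apply (cJ2 i))).mul (cp _)).sub
        (c0.mul (cp _))
  rw [← integral_const_mul, ← integral_const_mul, ← integral_const_mul,
    ← integral_add, ← integral_add, ← neg_eq_zero, ← integral_neg]
  · rw [← hsum]
    congr 1
    ext σ
    -- Splitting the Laplacian into radial and angular Hessian terms lets the Helmholtz equation
    -- replace the sum of angular terms by `-∂_r² u - k² u`.
    have hl := hH _ (smul_sphere_mem hR hr σ)
    rw [laplacian_eq_sum_stdVec, ← sum_bilin_rotGen _ σ] at hl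
    have hJ : ∑ i, fderiv ℝ u (r • (σ : Space3)) (rotGen i (rotGen i σ))
        = -2 * fderiv ℝ u (r • (σ : Space3)) σ := by
      rw [← map_sum, sum_rotGen_sq, map_smul, Complex.real_smul]
      push_cast
      ring
    have hP : ∑ i, (starRingEnd ℂ) (polyFun (polyRot i (polyRot i p)) σ)
        = -(n * (n + 1)) * (starRingEnd ℂ) (polyFun p σ) := by
      have := congrArg (fun q => (starRingEnd ℂ) (polyFun q σ)) (sum_polyRot_polyRot hp hharm)
      simpa [polyFun] using this
    simp only [map_smul, Finset.sum_sub_distrib, ← Finset.sum_mul, ← Finset.mul_sum,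
      Finset.sum_add_distrib, hP, hJ, smul_apply, Complex.real_smul]
    linear_combination (-(r : ℂ) ^ 2 * (starRingEnd ℂ) (polyFun p σ)) * hl
  · exact integrable_sphere ((continuous_const.mul (((c2.clm_apply cσ).clm_apply cσ).mul (cp p))).add
      (continuous_const.mul ((c1.clm_apply cσ).mul (cp p))))
  · exact integrable_sphere (continuous_const.mul (c0.mul (cp p)))
  · exact integrable_sphere (continuous_const.mul (((c2.clm_apply cσ).clm_apply cσ).mul (cp p)))
  · exact integrable_sphere (continuous_const.mul ((c1.clm_apply cσ).mul (cp p)))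

/-- First derivative of the moments. -/
theorem hasDerivAt_moment (hR : 0 ≤ R) (hu : ContDiffOn ℝ 2 u {x | R < ‖x‖})
    {q : Sphere2 → ℂ} (hq : Continuous q) {r : ℝ} (hr : R < r) :
    HasDerivAt (fun r => ∫ σ : Sphere2, u (r • (σ : Space3)) * q σ ∂surfaceMeasure)
      (∫ σ : Sphere2, fderiv ℝ u (r • (σ : Space3)) σ * q σ ∂surfaceMeasure) r := by
  refine hasDerivAt_integral_sphere (s := Set.Ioi R) isOpen_Ioi
    (F := fun r σ => u (r • (σ : Space3)) * q σ)
    (F' := fun r σ => fderiv ℝ u (r • (σ : Space3)) σ * q σ)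
    (fun r hr => (continuous_comp_smul_sphere hR hu.continuousOn hr).mul hq)
    (((continuousOn_comp_smul_sphere hR (contDiffOn_fderiv hu).continuousOn).clm_apply
      (by fun_prop)).mul (by fun_prop)) (fun r hr σ => ?_) hr
  have h : HasDerivAt (fun r => r • (σ : Space3)) σ r := by
    simpa using (hasDerivAt_id r).smul_const (σ : Space3)
  exact (hasDerivAt_comp_curve hu (γ := fun r => r • (σ : Space3))
    (smul_sphere_mem hR hr σ) h).mul_const (q σ)

/-- Second derivative of the moments. -/
theorem hasDerivAt_moment_deriv (hR : 0 ≤ R) (hu : ContDiffOn ℝ 2 u {x | R < ‖x‖})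
    {q : Sphere2 → ℂ} (hq : Continuous q) {r : ℝ} (hr : R < r) :
    HasDerivAt (fun r => ∫ σ : Sphere2, fderiv ℝ u (r • (σ : Space3)) σ * q σ ∂surfaceMeasure)
      (∫ σ : Sphere2, fderiv ℝ (fderiv ℝ u) (r • (σ : Space3)) σ σ * q σ ∂surfaceMeasure) r := by
  refine hasDerivAt_integral_sphere (s := Set.Ioi R) isOpen_Ioi
    (F := fun r σ => fderiv ℝ u (r • (σ : Space3)) σ * q σ)
    (F' := fun r σ => fderiv ℝ (fderiv ℝ u) (r • (σ : Space3)) σ σ * q σ)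
    (fun r hr => ((continuous_comp_smul_sphere hR (contDiffOn_fderiv hu).continuousOn hr).clm_apply
      continuous_subtype_val).mul hq)
    ((((continuousOn_comp_smul_sphere hR (continuousOn_fderiv_fderiv hu)).clm_apply
      (by fun_prop)).clm_apply (by fun_prop)).mul (by fun_prop)) (fun r hr σ => ?_) hr
  have h : HasDerivAt (fun r => r • (σ : Space3)) σ r := by
    simpa using (hasDerivAt_id r).smul_const (σ : Space3)
  have h1 := hasDerivAt_fderiv_comp_curve hu (γ := fun r => r • (σ : Space3))
    (smul_sphere_mem hR hr σ) h
    (hasDerivAt_const r (σ : Space3))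
  rw [map_zero, add_zero] at h1
  exact h1.mul_const (q σ)

end Exterior

/-! ### Limits at infinity and at the sphere of radius `R`. -/

theorem exists_norm_le_sphere {q : Sphere2 → ℂ} (hq : Continuous q) : ∃ Q > 0, ∀ σ, ‖q σ‖ ≤ Q := by
  obtain ⟨Q, hQ⟩ := (isCompact_univ (X := Sphere2)).exists_bound_of_continuousOn hq.continuousOn
  exact ⟨max Q 1, by positivity, fun σ => (hQ σ trivial).trans (le_max_left _ _)⟩

/-- Uniform convergence to zero passes to integrals over the sphere against a bounded weight. -/
theorem tendsto_integral_mul_zero {l : Filter ℝ} {f : ℝ → Sphere2 → ℂ} {q : Sphere2 → ℂ}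
    (hq : Continuous q) (hf : TendstoUniformly f 0 l) :
    Tendsto (fun r => ∫ σ, f r σ * q σ ∂surfaceMeasure) l (𝓝 0) := by
  obtain ⟨Q, hQ, hb⟩ := exists_norm_le_sphere hq
  rw [Metric.tendsto_nhds]
  intro ε hε
  set m := surfaceMeasure.real Set.univ
  have hm : 0 ≤ m := measureReal_nonneg
  have hδ : 0 < ε / (Q * (m + 1)) := by positivity
  filter_upwards [Metric.tendstoUniformly_iff.1 hf _ hδ] with r hr
  rw [dist_zero_right]
  refine (norm_integral_le_of_norm_le_const (C := ε / (Q * (m + 1)) * Q)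
    (Eventually.of_forall fun σ => ?_)).trans_lt ?_
  · have h := (hr σ).le
    rw [Pi.zero_apply, dist_zero_left] at h
    rw [norm_mul]
    gcongr
    exact hb σ
  · calc ε / (Q * (m + 1)) * Q * m = ε * (m / (m + 1)) := by field_simp
      _ < ε * 1 := by gcongr; rw [div_lt_one (by positivity)]; linarith
      _ = ε := mul_one ε

theorem radialDeriv_smul (u : Space3 → ℂ) {r : ℝ} (hr : 0 < r) (σ : Sphere2) :
    radialDeriv u (r • (σ : Space3)) = fderiv ℝ u (r • (σ : Space3)) σ := by
  have h : ‖r • (σ : Space3)‖ = r := by simp [norm_smul, abs_of_pos hr]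
  rw [radialDeriv, h, smul_smul, inv_mul_cancel₀ hr.ne', one_smul]

/-- The limit along `cobounded` depends on `‖x‖` alone, since that filter is the pullback of `atTop`
under the norm; this is uniformity in the direction. -/
theorem tendstoUniformly_radiating {k : ℝ} {u : Space3 → ℂ} (h : IsRadiating k u) :
    TendstoUniformly (fun (r : ℝ) (σ : Sphere2) => (r : ℂ) *
      (fderiv ℝ u (r • (σ : Space3)) σ - Complex.I * k * u (r • (σ : Space3)))) 0 atTop := by
  rw [Metric.tendstoUniformly_iff]
  intro ε hε
  have h1 := Metric.tendsto_nhds.1 h ε hε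
  rw [← comap_norm_atTop, eventually_comap] at h1
  filter_upwards [h1, eventually_gt_atTop 0] with r hr hr0 σ
  have hn : ‖r • (σ : Space3)‖ = r := by simp [norm_smul, abs_of_pos hr0]
  have := hr _ hn
  rwa [hn, radialDeriv_smul u hr0, dist_comm] at this

theorem tendstoUniformly_amplitude {k : ℝ} {u : Space3 → ℂ} {A : Sphere2 → ℂ}
    (h : IsScatteringAmplitude k u A) :
    TendstoUniformly (fun (r : ℝ) (σ : Sphere2) => (r : ℂ) * u (r • (σ : Space3))
      - Complex.exp (Complex.I * k * r) * A σ) 0 atTop := by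
  obtain ⟨C, hC⟩ := h
  rw [Metric.tendstoUniformly_iff]
  intro ε hε
  have h1 : Tendsto (fun r : ℝ => C / r) atTop (𝓝 0) := tendsto_const_nhds.div_atTop tendsto_id
  filter_upwards [hC, h1.eventually_lt_const hε, eventually_gt_atTop 0] with r hr hr1 hr0 σ
  have hrc : (r : ℂ) ≠ 0 := by exact_mod_cast hr0.ne'
  rw [Pi.zero_apply, dist_zero_left]
  refine lt_of_le_of_lt ?_ hr1
  have e : (r : ℂ) * u (r • (σ : Space3)) - Complex.exp (Complex.I * k * r) * A σ
      = r * (u (r • (σ : Space3)) - Complex.exp (Complex.I * k * r) / r * A σ) := by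
    field_simp
  rw [e, norm_mul, Complex.norm_real, Real.norm_of_nonneg hr0.le]
  calc r * ‖u (r • (σ : Space3)) - Complex.exp (Complex.I * k * r) / r * A σ‖
      ≤ r * (C / r ^ 2) := by gcongr; exact hr σ
    _ = C / r := by field_simp

/-- The scattering amplitude is continuous. -/
theorem continuous_amplitude {k R : ℝ} (hR : 0 ≤ R) {u : Space3 → ℂ}
    (hu : ContinuousOn u {x | R < ‖x‖}) {A : Sphere2 → ℂ} (h : IsScatteringAmplitude k u A) :
    Continuous A := by
  -- Removing the phase exhibits `A` as a uniform limit of continuous functions.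
  have h1 : TendstoUniformly (fun (r : ℝ) (σ : Sphere2) => Complex.exp (Complex.I * ((-k * r : ℝ)))
      * (r * u (r • (σ : Space3)))) A atTop := by
    rw [Metric.tendstoUniformly_iff]
    intro ε hε
    filter_upwards [Metric.tendstoUniformly_iff.1 (tendstoUniformly_amplitude h) ε hε] with r hr σ
    have h2 := hr σ
    rw [Pi.zero_apply, dist_zero_left] at h2
    rw [dist_comm, dist_eq_norm]
    have e : Complex.exp (Complex.I * ((-k * r : ℝ))) * (r * u (r • (σ : Space3))) - A σ
        = Complex.exp (Complex.I * ((-k * r : ℝ))) * (r * u (r • (σ : Space3))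
          - Complex.exp (Complex.I * k * r) * A σ) := by
      have : Complex.exp (Complex.I * ((-k * r : ℝ))) * Complex.exp (Complex.I * k * r) = 1 := by
        rw [← Complex.exp_add]
        push_cast
        rw [show Complex.I * (-k * r) + Complex.I * k * r = 0 by ring, Complex.exp_zero]
      linear_combination A σ * this
    rwa [e, norm_mul, norm_exp_I_mul, one_mul]
  refine h1.continuous (Eventually.frequently ?_)
  filter_upwards [eventually_gt_atTop R] with r hr
  exact continuous_const.mul (continuous_const.mul (continuous_comp_smul_sphere hR hu hr))

/-- Convergence of the moments of the radial derivative to those of its trace. -/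
theorem tendsto_moment_trace {R : ℝ} (hR : 0 ≤ R) {u : Space3 → ℂ}
    (hu : ContDiffOn ℝ 2 u {x | R < ‖x‖}) {g : Sphere2 → ℂ} (hg : IsRadialDerivTrace R u g)
    {q : Sphere2 → ℂ} (hq : Continuous q) :
    Tendsto (fun r : ℝ => ∫ σ : Sphere2, fderiv ℝ u (r • (σ : Space3)) σ * q σ ∂surfaceMeasure)
      (𝓝[>] R) (𝓝 (∫ σ, g σ * q σ ∂surfaceMeasure)) := by
  obtain ⟨Q, hQ, hb⟩ := exists_norm_le_sphere hq
  have hc : ∀ r, R < r → Continuous fun σ : Sphere2 => fderiv ℝ u (r • (σ : Space3)) σ :=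
    fun r hr => (continuous_comp_smul_sphere hR (contDiffOn_fderiv hu).continuousOn hr).clm_apply
      continuous_subtype_val
  refine tendsto_integral_of_L1' _ ?_ ?_ ?_
  · refine ((hg.1.integrable (by norm_num)).mul_bdd (c := Q) hq.aestronglyMeasurable
      (Eventually.of_forall hb)).aestronglyMeasurable
  · filter_upwards [self_mem_nhdsWithin] with r hr
    exact integrable_sphere ((hc r hr).mul hq)
  -- The sphere has finite measure, so convergence in `L²` gives convergence in `L¹`, with Hölder
  -- constant `c`.
  · set c : ℝ≥0∞ := surfaceMeasure Set.univ ^ (1 / (1 : ℝ≥0∞).toReal - 1 / (2 : ℝ≥0∞).toReal)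
    have hcfin : c ≠ ⊤ := ENNReal.rpow_ne_top_of_nonneg (by norm_num) (measure_ne_top _ _)
    have hlim : Tendsto (fun r : ℝ => ENNReal.ofReal Q * (eLpNorm (fun σ : Sphere2 =>
        radialDeriv u (r • (σ : Space3)) - g σ) 2 surfaceMeasure * c)) (𝓝[>] R) (𝓝 0) := by
      have := ENNReal.Tendsto.const_mul (ENNReal.Tendsto.mul_const hg.2 (Or.inr hcfin))
        (Or.inr (ENNReal.ofReal_ne_top (r := Q)))
      simpa using this
    refine tendsto_of_tendsto_of_tendsto_of_le_of_le' tendsto_const_nhds hlim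
      (Eventually.of_forall fun _ => zero_le) ?_
    filter_upwards [self_mem_nhdsWithin] with r hr
    have hr0 : 0 < r := hR.trans_lt hr
    have hm : AEStronglyMeasurable (fun σ : Sphere2 =>
        radialDeriv u (r • (σ : Space3)) - g σ) surfaceMeasure := by
      simp only [radialDeriv_smul u hr0]
      exact (hc r hr).aestronglyMeasurable.sub hg.1.1
    refine (eLpNorm_le_mul_eLpNorm_of_ae_le_mul (c := Q)
      (g := fun σ : Sphere2 => radialDeriv u (r • (σ : Space3)) - g σ)
      (Eventually.of_forall fun σ => ?_) 1).trans ?_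
    · rw [Pi.sub_apply, ← sub_mul, norm_mul, radialDeriv_smul u hr0, mul_comm]
      gcongr
      exact hb σ
    · gcongr
      exact eLpNorm_le_eLpNorm_mul_rpow_measure_univ (by norm_num) hm

/-! ### From the scattering amplitude to the trace, degree by degree. -/

/-- The coefficients of the trace of `∂_r u` are those of the scattering amplitude, multiplied by
the derivative of a spherical Hankel function. -/
theorem integral_trace_eq {k R : ℝ} (hk : 0 < k) (hR : 0 < R) {u : Space3 → ℂ}
    (hu : ContDiffOn ℝ 2 u {x | R < ‖x‖})
    (hH : ∀ x ∈ {x : Space3 | R < ‖x‖}, Laplacian.laplacian u x + (k : ℂ) ^ 2 * u x = 0)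
    (hrad : IsRadiating k u) {A : Sphere2 → ℂ} (hA : IsScatteringAmplitude k u A)
    {g : Sphere2 → ℂ} (hg : IsRadialDerivTrace R u g) {n : ℕ} {f : Sphere2 → ℂ}
    (hf : IsSphericalHarmonic n f) :
    (R : ℂ) * ∫ σ, g σ * (starRingEnd ℂ) (f σ) ∂surfaceMeasure
      = k * (∫ σ, A σ * (starRingEnd ℂ) (f σ) ∂surfaceMeasure)
        * (hankelDeriv n (k * R) - hankel n (k * R) / ((k * R : ℝ) : ℂ)) := by
  obtain ⟨p, hp, hharm, hfp⟩ := hf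
  have hfp' : ∀ σ, f σ = polyFun p σ := hfp
  simp only [hfp']
  have hq : Continuous fun σ : Sphere2 => (starRingEnd ℂ) (polyFun p σ) :=
    Complex.continuous_conj.comp ((continuous_polyFun p).comp continuous_subtype_val)
  have hAc := continuous_amplitude hR.le hu.continuousOn hA
  have hbes := fun r (hr : R < r) => integral_spherical_bessel hR.le hu hH hp hharm hr
  have hd1 := fun r (hr : R < r) => hasDerivAt_moment hR.le hu hq hr
  have hd2 := fun r (hr : R < r) => hasDerivAt_moment_deriv hR.le hu hq hr
  have htr := tendsto_moment_trace hR.le hu hg hq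
  have hamp := tendsto_integral_mul_zero hq (tendstoUniformly_amplitude hA)
  have hra := tendsto_integral_mul_zero hq (tendstoUniformly_radiating hrad)
  have i0 : ∀ r, R < r → Integrable (fun σ : Sphere2 => u (r • (σ : Space3))
      * (starRingEnd ℂ) (polyFun p σ)) surfaceMeasure := fun r hr =>
    integrable_sphere ((continuous_comp_smul_sphere hR.le hu.continuousOn hr).mul hq)
  have i1 : ∀ r, R < r → Integrable (fun σ : Sphere2 => fderiv ℝ u (r • (σ : Space3)) σ
      * (starRingEnd ℂ) (polyFun p σ)) surfaceMeasure := fun r hr =>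
    integrable_sphere (((continuous_comp_smul_sphere hR.le (contDiffOn_fderiv hu).continuousOn
      hr).clm_apply continuous_subtype_val).mul hq)
  have iA : Integrable (fun σ : Sphere2 => A σ * (starRingEnd ℂ) (polyFun p σ)) surfaceMeasure :=
    integrable_sphere (hAc.mul hq)
  set a : ℂ := ∫ σ : Sphere2, A σ * (starRingEnd ℂ) (polyFun p σ) ∂surfaceMeasure
  set w : ℝ → ℂ := fun r => ∫ σ : Sphere2, u (r • (σ : Space3))
    * (starRingEnd ℂ) (polyFun p σ) ∂surfaceMeasure with hw
  set w' : ℝ → ℂ := fun r => ∫ σ : Sphere2, fderiv ℝ u (r • (σ : Space3)) σ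
    * (starRingEnd ℂ) (polyFun p σ) ∂surfaceMeasure with hw'
  set w'' : ℝ → ℂ := fun r => ∫ σ : Sphere2, fderiv ℝ (fderiv ℝ u) (r • (σ : Space3)) σ σ
    * (starRingEnd ℂ) (polyFun p σ) ∂surfaceMeasure
  have hr1 : ∀ r : ℝ, HasDerivAt (fun r : ℝ => (r : ℂ)) 1 r := fun r =>
    (hasDerivAt_id (r : ℂ)).comp_ofReal
  have hv : ∀ r > R, HasDerivAt (fun r : ℝ => (r : ℂ) * w r) (w r + r * w' r) r := fun r hr =>
    ((hr1 r).mul (hd1 r hr)).congr_deriv (by ring)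
  have hv' : ∀ r > R, HasDerivAt (fun r : ℝ => w r + (r : ℂ) * w' r)
      (((n : ℂ) * (n + 1) / r ^ 2 - k ^ 2) * (r * w r)) r := fun r hr => by
    have hr0 : (r : ℂ) ≠ 0 := by exact_mod_cast (hR.trans hr).ne'
    refine ((hd1 r hr).add ((hr1 r).mul (hd2 r hr))).congr_deriv ?_
    have hb : (r : ℂ) ^ 2 * w'' r + 2 * r * w' r
      + ((k : ℂ) ^ 2 * r ^ 2 - n * (n + 1)) * w r = 0 := hbes r hr
    field_simp
    linear_combination hb
  have hamp' : Tendsto (fun r : ℝ => (r : ℂ) * w r - Complex.exp (Complex.I * k * r) * a)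
      atTop (𝓝 0) := by
    refine hamp.congr' ?_
    filter_upwards [eventually_gt_atTop R] with r hr
    rw [hw, ← integral_const_mul, ← integral_const_mul,
      ← integral_sub ((i0 r hr).const_mul _) (iA.const_mul _)]
    congr 1
    ext σ
    ring
  -- The derivative of `r w` is `w + r w'`, whereas the radiation condition controls only `r w' - i
  -- k r w`; the extra `w` must be shown to vanish at infinity.
  have hw0 : Tendsto w atTop (𝓝 0) := by
    have h1 : Tendsto (fun r : ℝ => ((r⁻¹ : ℝ) : ℂ)) atTop (𝓝 0) := by
      exact_mod_cast (Complex.continuous_ofReal.tendsto 0).comp tendsto_inv_atTop_zero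
    have h2 : Tendsto (fun r : ℝ => ((r⁻¹ : ℝ) : ℂ) * (Complex.exp (Complex.I * k * r) * a))
        atTop (𝓝 0) := by
      have := (h1.mul_const a).norm
      rw [zero_mul, norm_zero] at this
      rw [tendsto_zero_iff_norm_tendsto_zero]
      refine this.congr fun r => ?_
      have e := norm_exp_I_mul (k * r)
      push_cast at e
      rw [norm_mul, norm_mul, norm_mul, mul_assoc Complex.I, e, one_mul]
    have := (h1.mul hamp').add h2
    rw [mul_zero, add_zero] at this
    refine this.congr' ?_
    filter_upwards [eventually_gt_atTop 0] with r hr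
    have hr0 : (r : ℂ) ≠ 0 := by exact_mod_cast hr.ne'
    push_cast
    field_simp
    ring
  have hrad' : Tendsto (fun r : ℝ => w r + (r : ℂ) * w' r - Complex.I * k * (r * w r))
      atTop (𝓝 0) := by
    have := hw0.add hra
    rw [add_zero] at this
    refine this.congr' ?_
    filter_upwards [eventually_gt_atTop R] with r hr
    rw [add_sub_assoc]
    congr 1
    simp only [hw, hw']
    rw [← integral_const_mul, ← integral_const_mul, ← integral_const_mul,
      ← integral_sub ((i1 r hr).const_mul _) (((i0 r hr).const_mul _).const_mul _)]
    congr 1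
    ext σ
    ring
  have key := fun r (hr : R < r) =>
    riccatiBessel_eq_hankel hk hR.le hv hv' hrad' hamp' hr
  -- The limit of `r w'(r)` as `r` decreases to `R` is computed twice: from the `L²` trace, and in
  -- `hlim2` from the explicit solution.
  have hlim1 : Tendsto (fun r : ℝ => (r : ℂ) * w' r) (𝓝[>] R)
      (𝓝 (R * ∫ σ : Sphere2, g σ * (starRingEnd ℂ) (polyFun p σ) ∂surfaceMeasure)) :=
    ((Complex.continuous_ofReal.tendsto R).mono_left nhdsWithin_le_nhds).mul htr
  have hkR : k * R ≠ 0 := (mul_pos hk hR).ne'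
  have hlin : Tendsto (fun r : ℝ => k * r) (𝓝[>] R) (𝓝 (k * R)) :=
    ((continuous_const.mul continuous_id).tendsto R).mono_left nhdsWithin_le_nhds
  have hh := (hasDerivAt_hankel n hkR).continuousAt.tendsto.comp hlin
  have hh' := (hasDerivAt_hankelDeriv n hkR).continuousAt.tendsto.comp hlin
  have hlim2 : Tendsto (fun r : ℝ => (r : ℂ) * w' r) (𝓝[>] R)
      (𝓝 (k * a * (hankelDeriv n (k * R) - hankel n (k * R) / ((k * R : ℝ) : ℂ)))) := by
    have hdiv := hh.div ((Complex.continuous_ofReal.tendsto (k * R)).comp hlin)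
      (by exact_mod_cast hkR)
    refine ((hh'.sub hdiv).const_mul (k * a : ℂ)).congr' ?_
    filter_upwards [self_mem_nhdsWithin] with r hr
    obtain ⟨e1, e2⟩ := key r hr
    have hr0 : (r : ℂ) ≠ 0 := by exact_mod_cast (hR.trans hr).ne'
    have hk0 : (k : ℂ) ≠ 0 := by exact_mod_cast hk.ne'
    have e3 : w r = a * hankel n (k * r) / r := by rw [← e1]; field_simp
    have e4 : (r : ℂ) * w' r = a * (k * hankelDeriv n (k * r)) - a * hankel n (k * r) / r := by
      rw [← e2, e3]; ring
    rw [e4]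
    simp only [Function.comp_apply, Pi.div_apply]
    push_cast
    field_simp
  exact tendsto_nhds_unique hlim1 hlim2

theorem degreeEnergy_nonneg (Y : ℕ → ℤ → Sphere2 → ℂ) (f : Sphere2 → ℂ) (n : ℕ) :
    0 ≤ degreeEnergy Y f n :=
  Finset.sum_nonneg fun _ _ => by positivity

theorem degreeEnergy_trace_eq {Y : ℕ → ℤ → Sphere2 → ℂ} (hY : IsSphericalHarmonicBase Y)
    {k R : ℝ} (hk : 0 < k) (hR : 0 < R) {u : Space3 → ℂ}
    (hu : ContDiffOn ℝ 2 u {x | R < ‖x‖})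
    (hH : ∀ x ∈ {x : Space3 | R < ‖x‖}, Laplacian.laplacian u x + (k : ℂ) ^ 2 * u x = 0)
    (hrad : IsRadiating k u) {A : Sphere2 → ℂ} (hA : IsScatteringAmplitude k u A)
    {g : Sphere2 → ℂ} (hg : IsRadialDerivTrace R u g) (n : ℕ) :
    R ^ 2 * degreeEnergy Y g n = k ^ 2 * degreeEnergy Y A n
      * ‖hankelDeriv n (k * R) - hankel n (k * R) / ((k * R : ℝ) : ℂ)‖ ^ 2 := by
  simp only [degreeEnergy, Finset.mul_sum, Finset.sum_mul]
  refine Finset.sum_congr rfl fun m hm => ?_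
  have h := congrArg (fun z => ‖z‖ ^ 2)
    (integral_trace_eq hk hR hu hH hrad hA hg (hY.isSphericalHarmonic n m hm))
  simpa only [norm_mul, mul_pow, Complex.norm_real, Real.norm_eq_abs, sq_abs, sphCoeff] using h

theorem continuous_of_isSphericalHarmonic {n : ℕ} {f : Sphere2 → ℂ}
    (hf : IsSphericalHarmonic n f) : Continuous f := by
  obtain ⟨p, -, -, h⟩ := hf
  rw [funext h]
  exact (continuous_polyFun p).comp continuous_subtype_val

/-- Bessel's inequality for continuous functions on the sphere. -/
theorem summable_degreeEnergy {Y : ℕ → ℤ → Sphere2 → ℂ} (hY : IsSphericalHarmonicBase Y)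
    {f : Sphere2 → ℂ} (hf : Continuous f) : Summable (degreeEnergy Y f) := by
  have hmem : ∀ {f : Sphere2 → ℂ}, Continuous f → MemLp f 2 surfaceMeasure := fun {f} hf => by
    obtain ⟨Q, -, hQ⟩ := exists_norm_le_sphere hf
    exact MemLp.of_bound hf.aestronglyMeasurable Q (Eventually.of_forall hQ)
  have hc : ∀ i : (Σ n : ℕ, Finset.Icc (-(n : ℤ)) n), Continuous (Y i.1 i.2) := fun i =>
    continuous_of_isSphericalHarmonic (hY.isSphericalHarmonic i.1 i.2 i.2.2)
  have hin : ∀ {f h : Sphere2 → ℂ} (hf : Continuous f) (hh : Continuous h),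
      inner ℂ ((hmem hh).toLp h) ((hmem hf).toLp f)
        = ∫ σ, f σ * (starRingEnd ℂ) (h σ) ∂surfaceMeasure := fun {f h} hf hh => by
    rw [L2.inner_def]
    refine integral_congr_ae ?_
    filter_upwards [(hmem hf).coeFn_toLp, (hmem hh).coeFn_toLp] with σ h1 h2
    rw [h1, h2]
    rfl
  have ho : Orthonormal ℂ fun i : (Σ n : ℕ, Finset.Icc (-(n : ℤ)) n) =>
      (hmem (hc i)).toLp (Y i.1 i.2) := by
    classical
    rw [orthonormal_iff_ite]
    intro i j
    rw [hin (hc j) (hc i), hY.orthonormal _ _ j.2.2 _ _ i.2.2]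
    obtain ⟨n, m, hm⟩ := i
    obtain ⟨n', m', hm'⟩ := j
    refine if_congr ⟨?_, ?_⟩ rfl rfl
    · rintro ⟨h1, h2⟩
      obtain rfl : n' = n := h1
      obtain rfl : m' = m := h2
      rfl
    · intro h
      cases h
      exact ⟨rfl, rfl⟩
  -- Bessel's inequality over all pairs `(n, m)`, regrouped by degree.
  have hs := (ho.inner_products_summable ((hmem hf).toLp f)).sigma
  refine hs.congr fun n => ?_
  rw [degreeEnergy, ← Finset.sum_coe_sort, tsum_fintype]
  refine Finset.sum_congr rfl fun m _ => ?_
  rw [hin hf (hc ⟨n, m⟩)]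
  rfl

/-! ### Numerical bounds for the majorant. -/

/-- Since `e^{2-Q} ≥ 3 - Q`, bounds `q ≤ Q/2` and `(1+q)/t ≤ d` reduce the claim to `(1+d)² ≤
(8/5)(3-Q)`, where `8/5` is a rational lower bound for `(3+√5)/π`. -/
theorem hankel_majorant_sq_le {n : ℕ} {t : ℝ} (ht : 2 ≤ t) (hn : (n : ℝ) ^ 2 ≤ t) :
    (Real.exp (n * (n + 1) / (2 * t)) * (1 + (1 + n * (n + 1) / (2 * t)) / t)) ^ 2
      ≤ Real.exp 2 / Real.pi * (3 + Real.sqrt 5) := by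
  have ht0 : 0 < t := by linarith
  have hc : (8 / 5 : ℝ) ≤ (3 + Real.sqrt 5) / Real.pi := by
    rw [le_div_iff₀ Real.pi_pos]
    have h5 : (11 / 5 : ℝ) ≤ Real.sqrt 5 := Real.le_sqrt_of_sq_le (by norm_num)
    linarith [Real.pi_lt_d2]
  refine le_trans ?_ ((mul_le_mul_of_nonneg_left hc (Real.exp_pos 2).le).trans_eq (by ring))
  -- reduction to numerical bounds for the exponent and the bracket
  have key : ∀ Q d : ℝ, (n : ℝ) * (n + 1) / (2 * t) ≤ Q / 2 →
      (1 + (n : ℝ) * (n + 1) / (2 * t)) / t ≤ d → (1 + d) ^ 2 ≤ (3 - Q) * (8 / 5) →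
      (Real.exp (n * (n + 1) / (2 * t)) * (1 + (1 + n * (n + 1) / (2 * t)) / t)) ^ 2
        ≤ Real.exp 2 * (8 / 5) := by
    intro Q d hQ hd hQd
    have hq : 0 ≤ (n : ℝ) * (n + 1) / (2 * t) := by positivity
    set q := (n : ℝ) * (n + 1) / (2 * t)
    have h1 : Real.exp q ^ 2 ≤ Real.exp Q := by
      rw [← Real.exp_nat_mul]
      exact Real.exp_le_exp.2 (by push_cast; linarith)
    have h2 : (1 + (1 + q) / t) ^ 2 ≤ (1 + d) ^ 2 := by
      have : 0 ≤ (1 + q) / t := by positivity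
      gcongr
    have h3 : 3 - Q ≤ Real.exp (2 - Q) := by linarith [Real.add_one_le_exp (2 - Q)]
    calc (Real.exp q * (1 + (1 + q) / t)) ^ 2 = Real.exp q ^ 2 * (1 + (1 + q) / t) ^ 2 := by ring
      _ ≤ Real.exp Q * (Real.exp (2 - Q) * (8 / 5)) := by
        gcongr
        exact (h2.trans hQd).trans (by gcongr)
      _ = Real.exp 2 * (8 / 5) := by
        rw [← mul_assoc, ← Real.exp_add]
        congr 2
        ring
  -- For `n = 0`, `q = 0`; for `n = 1`, `q = 1/t ≤ 1/2`. For `n ≥ 2`, `n² ≤ t` forces `t ≥ 4` and `q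
  -- ≤ (1 + 1/n)/2 ≤ 3/4`. In each case `d` is the resulting bound for `(1+q)/t`.
  rcases Nat.lt_or_ge n 2 with h | h
  · interval_cases n
    · refine key 0 (1 / 2) (by simp) ?_ (by norm_num)
      rw [div_le_iff₀ ht0]
      simp
      linarith
    · have hq : ((1 : ℕ) : ℝ) * ((1 : ℕ) + 1) / (2 * t) ≤ 1 / 2 := by
        rw [div_le_iff₀ (by positivity)]
        push_cast
        linarith
      refine key 1 (3 / 4) hq ?_ (by norm_num)
      rw [div_le_iff₀ ht0]
      linarith
  · have hn2 : (2 : ℝ) ≤ n := by exact_mod_cast h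
    have ht4 : 4 ≤ t := by nlinarith
    have hq : (n : ℝ) * (n + 1) / (2 * t) ≤ (3 / 2) / 2 := by
      rw [div_le_iff₀ (by positivity)]
      nlinarith
    refine key (3 / 2) (7 / 16) hq ?_ (by norm_num)
    rw [div_le_iff₀ ht0]
    linarith

/-- By `1 + y ≤ e^y` the exponent is at most `2(q + (1+q)/t)`. As `t ≥ 2` gives `q ≤ n(n+1)/4`, the
claim follows from `1 + (3/4) n(n+1) ≤ (n+1)²`. -/
theorem hankel_majorant_sq_le_exp (n : ℕ) {t : ℝ} (ht : 2 ≤ t) :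
    (Real.exp (n * (n + 1) / (2 * t)) * (1 + (1 + n * (n + 1) / (2 * t)) / t)) ^ 2
      ≤ Real.exp (2 * ((n : ℝ) + 1) ^ 2 / t) := by
  have ht0 : 0 < t := by linarith
  have hq4 : (n : ℝ) * (n + 1) / (2 * t) ≤ n * (n + 1) / 4 := by
    gcongr
    linarith
  have hq : 0 ≤ (n : ℝ) * (n + 1) / (2 * t) := by positivity
  have hqt : (n : ℝ) * (n + 1) / (2 * t) = (n * (n + 1) / 2) / t := by field_simp
  set q := (n : ℝ) * (n + 1) / (2 * t)
  have h1 : q + (1 + q) / t ≤ ((n : ℝ) + 1) ^ 2 / t := by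
    nth_rewrite 1 [hqt]
    rw [← add_div]
    gcongr
    have : (0 : ℝ) ≤ n := n.cast_nonneg
    nlinarith
  calc (Real.exp q * (1 + (1 + q) / t)) ^ 2
      ≤ (Real.exp q * Real.exp ((1 + q) / t)) ^ 2 := by
        gcongr
        linarith [Real.add_one_le_exp ((1 + q) / t)]
    _ = Real.exp (2 * (q + (1 + q) / t)) := by
      rw [← Real.exp_add, ← Real.exp_nat_mul]
      push_cast
      rfl
    _ ≤ _ := by
      rw [Real.exp_le_exp, mul_div_assoc]
      linarith

/-! ### Interpolation with the Sobolev norm and conclusion. -/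

theorem sobolevNormSq_zero (Y : ℕ → ℤ → Sphere2 → ℂ) (R : ℝ) (f : Sphere2 → ℂ) :
    sobolevNormSq Y R 0 f = ∑' n, ENNReal.ofReal (R ^ 2 * degreeEnergy Y f n) := by
  simp only [sobolevNormSq, zero_add, Finset.sum_range_one, mul_zero, pow_zero, one_mul]
  rw [← ENNReal.tsum_mul_left]
  simp only [ENNReal.ofReal_mul (sq_nonneg R)]

theorem tsum_le_sobolevNormSq_one (Y : ℕ → ℤ → Sphere2 → ℂ) (R : ℝ) (f : Sphere2 → ℂ) :
    ENNReal.ofReal (R ^ 2) * ∑' n : ℕ, ENNReal.ofReal ((n / R) ^ 2 * degreeEnergy Y f n)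
      ≤ sobolevNormSq Y R 1 f := by
  rw [sobolevNormSq, Finset.sum_range_succ, mul_one]
  gcongr
  exact le_add_self

/-- The bound for a single high frequency, by interpolation between the scattering amplitude and
the Sobolev norm. -/
theorem high_frequency_le {k R E ε B x a : ℝ} {n : ℕ} (hR : 0 < R) (hkR : 2 ≤ k * R)
    (hE0 : 0 ≤ E) (hε : 0 < ε) (hE : E = -Real.log ε) (hn : 1 ≤ n) (hx : 0 ≤ x) (ha : 0 ≤ a)
    (hxa : R ^ 2 * x = k ^ 2 * a * B ^ 2)
    (hB : B ^ 2 ≤ Real.exp (2 * ((n : ℝ) + 1) ^ 2 / (k * R))) :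
    ENNReal.ofReal (R ^ 2 * x) ≤ ENNReal.ofReal (k ^ 2 * Real.exp (2 / R) / ε * a)
      + ENNReal.ofReal (R ^ 2) * (ENNReal.ofReal (R ^ 2) * ENNReal.ofReal ((n / R) ^ 2 * x))
        / ENNReal.ofReal (E + k - 2 * Real.sqrt (E + k) + 1) := by
  have hk : 0 < k := by
    by_contra h
    nlinarith
  have hEk : 0 ≤ E + k := by linarith
  set s := Real.sqrt (E + k)
  have hs0 : 0 ≤ s := Real.sqrt_nonneg _
  have hs2 : s ^ 2 = E + k := Real.sq_sqrt hEk
  have hden : E + k - 2 * s + 1 = (s - 1) ^ 2 := by rw [← hs2]; ring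
  rw [hden]
  have hn0 : (1 : ℝ) ≤ n := by exact_mod_cast hn
  rcases lt_or_ge ((n : ℝ) + 1) s with h | h
  · refine le_add_right (ENNReal.ofReal_le_ofReal ?_)
    have hns : ((n : ℝ) + 1) ^ 2 ≤ E + k := by rw [← hs2]; gcongr
    have hexp : Real.exp (2 / R) / ε = Real.exp (2 / R + E) := by
      rw [Real.exp_add, hE, Real.exp_neg, Real.exp_log hε, div_eq_mul_inv]
    -- Below the threshold `(n+1)² ≤ E + k`: the part with `k` gives `2/R`, and the part with `E`
    -- gives `2E/(kR) ≤ E` because `kR ≥ 2`.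
    have hle : 2 * ((n : ℝ) + 1) ^ 2 / (k * R) ≤ 2 / R + E := by
      have hkRpos : 0 < k * R := by positivity
      rw [div_le_iff₀ hkRpos]
      have : 2 / R * (k * R) = 2 * k := by field_simp
      nlinarith
    rw [hxa, mul_div_assoc, hexp]
    calc k ^ 2 * a * B ^ 2 ≤ k ^ 2 * a * Real.exp (2 / R + E) := by
          gcongr
          exact hB.trans (Real.exp_le_exp.2 hle)
      _ = _ := by ring
  · refine le_add_left ?_
    -- The lower bound `-n ≤ s - 1` holds because `s ≥ 0` and `n ≥ 1`.
    have hsn : (s - 1) ^ 2 ≤ (n : ℝ) ^ 2 := sq_le_sq' (by linarith) (by linarith)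
    rw [← ENNReal.ofReal_mul (sq_nonneg R), ← ENNReal.ofReal_mul (sq_nonneg R)]
    have hnum : R ^ 2 * (R ^ 2 * ((n / R) ^ 2 * x)) = n ^ 2 * (R ^ 2 * x) := by field_simp
    rw [hnum]
    -- The denominator vanishes when `E + k = 1`. In `ℝ≥0∞`, `0 / 0 = 0` and `c / 0 = ⊤` for `c ≠
    -- 0`, so `x = 0` is treated apart.
    rcases hx.eq_or_lt with rfl | hx
    · simp
    rw [ENNReal.le_div_iff_mul_le (Or.inr (ENNReal.ofReal_pos.2 (by positivity)).ne')
        (Or.inl ENNReal.ofReal_ne_top),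
      ← ENNReal.ofReal_mul (by positivity), mul_comm]
    gcongr

theorem theorem1p2
    (Y : ℕ → ℤ → Sphere2 → ℂ) (hY : IsSphericalHarmonicBase Y)
    (k R : ℝ) (hR : 0 < R) (hkR : 2 ≤ k * R)
    (D : Set Space3) (hD : D ⊆ Metric.closedBall 0 R)
    (u : Space3 → ℂ) (hu : IsHelmholtzSolution k (closure D)ᶜ u) (hrad : IsRadiating k u)
    (A : Sphere2 → ℂ) (hA : IsScatteringAmplitude k u A)
    (g : Sphere2 → ℂ) (hg : IsRadialDerivTrace R u g)
    (N : ℕ) (hN : N = ⌊Real.sqrt (k * R)⌋₊)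
    (ε₁ ε₂ E : ℝ) (hε₁ : ε₁ = lowPart Y N A) (hε₂ : ε₂ = highPart Y N A)
    (hE : E = -Real.log ε₂) (hsmall : ε₂ ≤ 1) :
    (0 < ε₂ →
      sobolevNormSq Y R 0 g ≤
        ENNReal.ofReal (Real.exp 2 / Real.pi * (3 + Real.sqrt 5) * k ^ 2 * ε₁ ^ 2)
        + ENNReal.ofReal (k ^ 2 * Real.exp (2 / R) * ε₂)
        + ENNReal.ofReal (R ^ 2) * sobolevNormSq Y R 1 g
            / ENNReal.ofReal (E + k - 2 * Real.sqrt (E + k) + 1)) ∧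
    -- for `ε₂ = 0`, i.e. `E = +∞`, the last two terms vanish
    (ε₂ = 0 →
      sobolevNormSq Y R 0 g ≤
        ENNReal.ofReal (Real.exp 2 / Real.pi * (3 + Real.sqrt 5) * k ^ 2 * ε₁ ^ 2)) := by
  have hk : 0 < k := by
    by_contra h
    nlinarith
  have hkRpos : 0 < k * R := by positivity
  have hsub : {x : Space3 | R < ‖x‖} ⊆ (closure D)ᶜ := fun x hx hxD => by
    have := closure_minimal hD Metric.isClosed_closedBall hxD
    rw [mem_closedBall_zero_iff] at this
    exact absurd hx (not_lt.2 this)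
  have hu2 : ContDiffOn ℝ 2 u {x | R < ‖x‖} := hu.1.mono hsub
  have hH : ∀ x ∈ {x : Space3 | R < ‖x‖}, Laplacian.laplacian u x + (k : ℂ) ^ 2 * u x = 0 :=
    fun x hx => hu.2 x (hsub hx)
  have hxa := degreeEnergy_trace_eq hY hk hR hu2 hH hrad hA hg
  have hB := fun n => norm_hankelDeriv_sub_le n hkRpos
  have hB2 := fun n => pow_le_pow_left₀ (norm_nonneg _) (hB n) 2
  set x := degreeEnergy Y g
  set a := degreeEnergy Y A
  have hx0 : ∀ n, 0 ≤ x n := degreeEnergy_nonneg Y g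
  have ha0 : ∀ n, 0 ≤ a n := degreeEnergy_nonneg Y A
  have hsum : Summable a :=
    summable_degreeEnergy hY (continuous_amplitude hR.le hu2.continuousOn hA)
  have hsumN : Summable fun n => a (N + 1 + n) :=
    hsum.comp_injective (add_right_injective (N + 1))
  have hε₁sq : ε₁ ^ 2 = ∑ n ∈ Finset.range (N + 1), a n := by
    rw [hε₁, lowPart, Real.sq_sqrt (Finset.sum_nonneg fun n _ => ha0 n)]
  have hε₂sq : ε₂ ^ 2 = ∑' n, a (N + 1 + n) := by
    rw [hε₂, highPart, Real.sq_sqrt (tsum_nonneg fun n => ha0 _)]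
  have hsplit : sobolevNormSq Y R 0 g = ∑ n ∈ Finset.range (N + 1), ENNReal.ofReal (R ^ 2 * x n)
      + ∑' n, ENNReal.ofReal (R ^ 2 * x (N + 1 + n)) := by
    rw [sobolevNormSq_zero, ← Summable.sum_add_tsum_nat_add' (k := N + 1) ENNReal.summable]
    simp only [add_comm _ (N + 1)]
    rfl
  have hlow : ∑ n ∈ Finset.range (N + 1), ENNReal.ofReal (R ^ 2 * x n)
      ≤ ENNReal.ofReal (Real.exp 2 / Real.pi * (3 + Real.sqrt 5) * k ^ 2 * ε₁ ^ 2) := by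
    rw [← ENNReal.ofReal_sum_of_nonneg fun n _ => mul_nonneg (sq_nonneg R) (hx0 n), hε₁sq,
      Finset.mul_sum]
    refine ENNReal.ofReal_le_ofReal (Finset.sum_le_sum fun n hn => ?_)
    have hnN : n ≤ N := Nat.lt_succ_iff.1 (Finset.mem_range.1 hn)
    have hnt : (n : ℝ) ^ 2 ≤ k * R := by
      have h1 : (n : ℝ) ≤ Real.sqrt (k * R) :=
        le_trans (by exact_mod_cast hN ▸ hnN) (Nat.floor_le (Real.sqrt_nonneg _))
      calc (n : ℝ) ^ 2 ≤ Real.sqrt (k * R) ^ 2 := by gcongr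
        _ = k * R := Real.sq_sqrt hkRpos.le
    rw [hxa n]
    calc k ^ 2 * a n * ‖_‖ ^ 2
        ≤ k ^ 2 * a n * (Real.exp 2 / Real.pi * (3 + Real.sqrt 5)) :=
          mul_le_mul_of_nonneg_left ((hB2 n).trans (hankel_majorant_sq_le hkR hnt))
            (mul_nonneg (sq_nonneg k) (ha0 n))
      _ = _ := by ring
  rw [hsplit]
  -- `Real.log 0 = 0` would give `E = 0` instead of `+∞`, so `ε₂ = 0` is a separate case.
  refine ⟨fun hpos => ?_, fun hzero => ?_⟩
  · rw [add_assoc]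
    refine add_le_add hlow ?_
    have hE0 : 0 ≤ E := by
      rw [hE]
      exact neg_nonneg.2 (Real.log_nonpos hpos.le hsmall)
    refine (ENNReal.tsum_le_tsum fun n => high_frequency_le hR hkR hE0 hpos hE (by omega)
      (hx0 _) (ha0 _) (hxa _) ((hB2 _).trans (hankel_majorant_sq_le_exp (N + 1 + n) hkR))).trans ?_
    rw [ENNReal.tsum_add]
    refine add_le_add (le_of_eq ?_) ?_
    -- The amplitudes sum to `ε₂²`, and one factor cancels against the denominator `ε₂`.
    · rw [← ENNReal.ofReal_tsum_of_nonneg (fun n => mul_nonneg (by positivity) (ha0 _))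
        (hsumN.mul_left _), tsum_mul_left, ← hε₂sq]
      congr 1
      field_simp
    · simp only [div_eq_mul_inv]
      rw [ENNReal.tsum_mul_right, ENNReal.tsum_mul_left, ENNReal.tsum_mul_left]
      gcongr
      -- Only the `j = 1` part of the Sobolev norm is needed; the tail over `n > N` is enlarged to
      -- the full series.
      refine le_trans ?_ (tsum_le_sobolevNormSq_one Y R g)
      refine mul_le_mul' le_rfl ?_
      exact ENNReal.tsum_comp_le_tsum_of_injective (add_right_injective (N + 1))
        fun n : ℕ => ENNReal.ofReal ((n / R) ^ 2 * x n)
  · have hz : ∀ n, a (N + 1 + n) = 0 := by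
      have h0 : ∑' n, a (N + 1 + n) = 0 := by rw [← hε₂sq, hzero]; norm_num
      exact congrFun ((hasSum_zero_iff_of_nonneg fun n => ha0 (N + 1 + n)).1
        (h0 ▸ hsumN.hasSum))
    have htail : ∑' n, ENNReal.ofReal (R ^ 2 * x (N + 1 + n)) = 0 := by
      simp [hxa, hz]
    rw [htail, add_zero]
    exact hlow
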